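/- A \emph{metric Bauer simplex} is a nonempty compact convex subset $X$ of a real Hausdorff locally convex space, with a metric $d_X$ inducing its topology, such that the set $\partial_eX$ of extreme points is compact, every $x\in X$ is represented by a unique Borel probability measure $\mu_x$ on $\partial_eX$ (that is, $a(x)=\int_{\partial_eX} a\,d\mu_x$ for every continuous affine $a\colon X\to\mathbb{R}$), and $d_X(x,y)=\sup\left\{\left|\int f\,d\mu_x-\int f\,d\mu_y\right| : f\colon\partial_eX\to\mathbb{R}\text{ is 1-Lipschitz for } d_X\right\}$. For compact convex metric spaces $X,Y$ and $\varepsilon>0$ let $\mathrm{Isom}_\varepsilon(X,Y)$ be the set of continuous affine maps $f\colon X\to Y$ such that $|d_Y(f(x_1),f(x_2))-d_X(x_1,x_2)|<\varepsilon$ for all $x_1,x_2\in X$ and such that there is a continuous affine $g\colon Y\to X$ with $d_Y(f(g(y)),y)<\varepsilon$ for all $y\in Y$. The \emph{intertwining gap} is $$\gamma(X,Y)=\inf\{\varepsilon>0 : \mathrm{Isom}_\varepsilon(X,Y)\neq\emptyset\text{ and }\mathrm{Isom}_\varepsilon(Y,X)\neq\emptyset\}.$$ For $\mathrm{C}^*$-algebraic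 quantum metric Choquet simplices $(A,L)$, $(B,M)$, the \emph{quantum intertwining gap} is $\gamma_q((A,L),(B,M))=\gamma((T(A),\rho_L),(T(B),\rho_M))$, where $T(\cdot)$ is the tracial state space and $\rho_L(\sigma,\tau)=\sup\{|\sigma(a)-\tau(a)| : L(a)\le1\}$. Here a \emph{$\mathrm{C}^*$-algebraic quantum metric Choquet simplex} is a separable unital $\mathrm{C}^*$-algebra $A$ with a self-adjoint, lower semicontinuous, densely finite seminorm $L\colon A\to[0,\infty]$ such that, with $A_0=\{\sum_n x_n^*x_n-\sum_n x_nx_n^*\}$ (both series norm convergent): (i) $T(A)\ne\emptyset$, and a self-adjoint $a$ agrees with a positive element modulo $A_0$ if and only if $\tau(a)\ge0$ for every $\tau\in T(A)$; (ii) $\ker L=\mathrm{span}_{\mathbb{C}}(\{1\}\cup A_0)$; (iii) $\rho_L$ is a metric inducing the $w^*$-topology on $T(A)$. It is a \emph{$\mathrm{C}^*$-algebraic quantum metric Bauer simplex} if moreover $(T(A),\rho_L)$ is a metric Bauer simplex. A \emph{compact quantum metric space} is an order unit space $(E,e)$ with a Lip-norm $L$, that is, a seminorm $L\colon E\to[0,\infty]$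 with kernel $\mathbb{R}e$ whose metric $\rho_L(\sigma,\tau)=\sup\{|\sigma(x)-\tau(x)| : L(x)\le1\}$ induces the $w^*$-topology on the state space $S(E)$. The \emph{quantum Gromov--Hausdorff distance} $\mathrm{dist}_q$ between $(E_1,L_1)$ and $(E_2,L_2)$ is the infimum, over the Lip-norms $L$ on $E_1\oplus E_2$ whose quotient seminorms on $E_1$ and $E_2$ are $L_1$ and $L_2$, of the Hausdorff distance between $S(E_1)$ and $S(E_2)$ in $(S(E_1\oplus E_2),\rho_L)$. For a metric Bauer simplex $X$, let $\mathrm{Aff}(X)$ be the space of continuous affine functions $X\to\mathbb{R}$ with order unit $1$ and the Lipschitz seminorm of $d_X$, and equip $C(\partial_eX)$ (complex-valued functions) with the Lipschitz seminorm of $d_X|_{\partial_eX}$. \textbf{Theorem.} \begin{enumerate} \item On the affine isometric isomorphism classes of metric Bauer simplices, $\gamma$ is a well-defined quasimetric with constant $2$: it is finite, nonnegative and symmetric, $\gamma(X,Y)=0$ if and only if $X$ and $Y$ are affinely isometrically isomorphic, and $\gamma(X,Z)\le2(\gamma(X,Y)+\gamma(Y,Z))$. \item For every metric Bauer simplex $X$,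 $\mathrm{Aff}(X)$ is a compact quantum metric space and $C(\partial_eX)$ is a (commutative) $\mathrm{C}^*$-algebraic quantum metric Bauer simplex, and for all metric Bauer simplices $X,Y$ one has $\gamma(X,Y)=\gamma_q(C(\partial_eX),C(\partial_eY))$. \item For all metric Bauer simplices $X,Y$, $\gamma(X,Y)=\gamma_q(C(\partial_eX),C(\partial_eY))\le2\,\mathrm{dist}_q(\mathrm{Aff}(X),\mathrm{Aff}(Y))$; and for every sequence $(X_n)$ of metric Bauer simplices and every metric Bauer simplex $X$, $\gamma(X_n,X)\to0$ if and only if $\mathrm{dist}_q(\mathrm{Aff}(X_n),\mathrm{Aff}(X))\to0$. \end{enumerate} -/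

import Mathlib

open Set Filter Topology MeasureTheory
open scoped ENNReal ComplexOrder

universe u v

noncomputable section

namespace QIG

/-! ### Affine maps, the intertwining gap -/

section Convex

variable {V : Type u} [AddCommGroup V] [Module ℝ V]
variable {W : Type v} [AddCommGroup W] [Module ℝ W]

/-- A map on a (convex) subset `X` of a real vector space is affine if it preserves convex
combinations. -/
def IsAffine {X : Set V} (f : X → W) : Prop :=
  ∀ (x y z : X) (s t : ℝ), 0 ≤ s → 0 ≤ t → s + t = 1 →
    (z : V) = s • (x : V) + t • (y : V) → f z = s • f x + t • f y

/-- An affine isometric isomorphism between sets with distance functions. -/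
structure AffineIsometry (X : Set V) (dX : X → X → ℝ) (Y : Set W) (dY : Y → Y → ℝ) where
  toEquiv : X ≃ Y
  affine : IsAffine (fun x => (toEquiv x : W))
  isometric : ∀ x₁ x₂, dY (toEquiv x₁) (toEquiv x₂) = dX x₁ x₂

variable [TopologicalSpace V] [TopologicalSpace W]

/-- The continuous affine maps `f : X → Y` that are `ε`-isometric and `ε`-invertible. -/
def epsIsom (ε : ℝ) (X : Set V) (dX : X → X → ℝ) (Y : Set W) (dY : Y → Y → ℝ) : Set (X → Y) :=
  {f | Continuous f ∧ IsAffine (fun x => (f x : W)) ∧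
    (∀ x₁ x₂, |dY (f x₁) (f x₂) - dX x₁ x₂| < ε) ∧
    ∃ g : Y → X, Continuous g ∧ IsAffine (fun y => (g y : V)) ∧ ∀ y, dY (f (g y)) y < ε}

/-- The intertwining gap `γ` (an infimum in `[0, ∞]`, so that `inf ∅ = ∞`). -/
def intertwiningGap (X : Set V) (dX : X → X → ℝ) (Y : Set W) (dY : Y → Y → ℝ) : ℝ≥0∞ :=
  sInf {r | ∃ ε : ℝ, 0 < ε ∧ (epsIsom ε X dX Y dY).Nonempty ∧ (epsIsom ε Y dY X dX).Nonempty ∧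
    r = ENNReal.ofReal ε}

end Convex

/-- The Lipschitz seminorm, with values in `[0, ∞]`. -/
def lipSeminorm {K : Type u} {F : Type v} [NormedAddCommGroup F] (d : K → K → ℝ)
    (f : K → F) : ℝ≥0∞ :=
  ⨆ (x : K) (y : K) (_ : x ≠ y), ENNReal.ofReal (‖f x - f y‖ / d x y)

/-! ### Metric Bauer simplices -/

section Bauer

variable {V : Type u} [AddCommGroup V] [Module ℝ V] [TopologicalSpace V]

/-- A nonempty compact convex set with a metric that induces its topology. -/
structure IsCompactConvexMetric (X : Set V) (d : X → X → ℝ) : Prop where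
  nonempty : X.Nonempty
  isCompact : IsCompact X
  convex : Convex ℝ X
  eq_zero_iff : ∀ x y, d x y = 0 ↔ x = y
  symm : ∀ x y, d x y = d y x
  triangle : ∀ x y z, d x z ≤ d x y + d y z
  mem_nhds_iff : ∀ (x : X) (s : Set X), s ∈ 𝓝 x ↔ ∃ ε > 0, {y | d x y < ε} ⊆ s

/-- The extremal boundary `∂ₑX`, with the subspace topology and the Borel `σ`-algebra. -/
def Boundary (X : Set V) : Type u := ↥(X.extremePoints ℝ)

instance (X : Set V) : TopologicalSpace (Boundary X) :=
  inferInstanceAs (TopologicalSpace ↥(X.extremePoints ℝ))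

instance (X : Set V) : MeasurableSpace (Boundary X) := borel _

instance (X : Set V) : BorelSpace (Boundary X) := ⟨rfl⟩

/-- The inclusion `∂ₑX ⊆ X`. -/
def Boundary.incl {X : Set V} (e : Boundary X) : X := ⟨e.1, extremePoints_subset e.2⟩

/-- `Aff(X)`: the continuous affine functions `X → ℝ`, with pointwise operations and order. -/
def Aff (X : Set V) : Submodule ℝ C(X, ℝ) where
  carrier := {f | IsAffine (fun x => f x)}
  add_mem' := by
    intro f g hf hg x y z s t hs ht hst hz
    have h1 := hf x y z s t hs ht hst hz
    have h2 := hg x y z s t hs ht hst hz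
    simp only [ContinuousMap.add_apply, smul_eq_mul] at *
    rw [h1, h2]; ring
  zero_mem' := by
    intro x y z s t _ _ _ _
    simp
  smul_mem' := by
    intro c f hf x y z s t hs ht hst hz
    have h1 := hf x y z s t hs ht hst hz
    simp only [ContinuousMap.smul_apply, smul_eq_mul] at *
    rw [h1]; ring

/-- The constant function `1`, the order unit of `Aff(X)`. -/
def Aff.unit (X : Set V) : Aff X := ⟨1, by
  intro x y z s t _ _ hst _
  simp [hst]⟩

/-- The probability measure `μ` on `∂ₑX` represents `x`. -/
def Represents {X : Set V} (μ : ProbabilityMeasure (Boundary X)) (x : X) : Prop :=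
  ∀ f : Aff X, f.1 x = ∫ e, f.1 e.incl ∂(μ : Measure (Boundary X))

/-- The Wasserstein distance between probability measures on a space with distance function `d`,
as a supremum in `[0, ∞]` over the `1`-Lipschitz functions. -/
def wasserstein {K : Type u} [MeasurableSpace K] (d : K → K → ℝ) (μ ν : ProbabilityMeasure K) :
    ℝ≥0∞ :=
  ⨆ (f : K → ℝ) (_ : ∀ x y, |f x - f y| ≤ d x y),
    ENNReal.ofReal |(∫ x, f x ∂(μ : Measure K)) - ∫ x, f x ∂(ν : Measure K)|

/-- `X` is a (metrisable) Choquet simplex with compact extremal boundary, whose metric is the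
Wasserstein metric of its restriction to the boundary, transported from `Prob(∂ₑX)` to `X` by
taking representing measures. -/
structure IsMetricBauerSimplex (X : Set V) (d : X → X → ℝ) : Prop
    extends IsCompactConvexMetric X d where
  existsUnique_represents : ∀ x : X, ∃! μ : ProbabilityMeasure (Boundary X), Represents μ x
  isCompact_extremePoints : IsCompact (X.extremePoints ℝ)
  dist_eq_wasserstein : ∀ (x y : X) (μ ν : ProbabilityMeasure (Boundary X)),
    Represents μ x → Represents ν y →
      ENNReal.ofReal (d x y) = wasserstein (fun e e' => d e.incl e'.incl) μ ν

end Bauer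

/-- A metric Bauer simplex, in some Hausdorff locally convex space. -/
structure MetricBauerSimplex where
  V : Type u
  [addCommGroup : AddCommGroup V]
  [module : Module ℝ V]
  [topologicalSpace : TopologicalSpace V]
  [isTopologicalAddGroup : IsTopologicalAddGroup V]
  [continuousSMul : ContinuousSMul ℝ V]
  [t2Space : T2Space V]
  [locallyConvexSpace : LocallyConvexSpace ℝ V]
  carrier : Set V
  dist : carrier → carrier → ℝ
  isMetricBauerSimplex : IsMetricBauerSimplex carrier dist

namespace MetricBauerSimplex

attribute [instance] addCommGroup module topologicalSpace isTopologicalAddGroup continuousSMul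
  t2Space locallyConvexSpace

/-- The intertwining gap `γ(X, Y)`. -/
def gap (X Y : MetricBauerSimplex.{u}) : ℝ≥0∞ :=
  intertwiningGap X.carrier X.dist Y.carrier Y.dist

/-- The compact metric space `∂ₑX`. -/
abbrev bdry (X : MetricBauerSimplex.{u}) : Type u := Boundary X.carrier

instance (X : MetricBauerSimplex.{u}) : CompactSpace X.bdry :=
  isCompact_iff_compactSpace.mp X.isMetricBauerSimplex.isCompact_extremePoints

/-- The Lipschitz seminorm of the boundary metric on `C(∂ₑX)`. -/
def bdryLip (X : MetricBauerSimplex.{u}) (f : C(X.bdry, ℂ)) : ℝ≥0∞ :=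
  lipSeminorm (fun e e' => X.dist e.incl e'.incl) f

/-- The Lipschitz seminorm on `Aff(X)`. -/
def affLip (X : MetricBauerSimplex.{u}) (f : Aff X.carrier) : ℝ≥0∞ := lipSeminorm X.dist f.1

/-- Affine isometric isomorphism is an equivalence relation. -/
instance setoid : Setoid MetricBauerSimplex.{u} where
  r X Y := Nonempty (AffineIsometry X.carrier X.dist Y.carrier Y.dist)
  iseqv :=
    { refl := fun X => ⟨⟨Equiv.refl _, fun _ _ _ _ _ _ _ _ h => h, fun _ _ => rfl⟩⟩
      symm := by
        rintro X Y ⟨φ⟩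
        refine ⟨⟨φ.toEquiv.symm, ?_, ?_⟩⟩
        · intro x y z s t hs ht hst hz
          have hmem : s • (φ.toEquiv.symm x : X.V) + t • (φ.toEquiv.symm y : X.V) ∈ X.carrier :=
            X.isMetricBauerSimplex.convex (φ.toEquiv.symm x).2 (φ.toEquiv.symm y).2 hs ht hst
          have h := φ.affine _ _ ⟨_, hmem⟩ s t hs ht hst rfl
          simp only [Equiv.apply_symm_apply] at h
          rw [← hz] at h
          have h' : φ.toEquiv.symm z = ⟨_, hmem⟩ := by
            rw [Equiv.symm_apply_eq]; exact (Subtype.ext h).symm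
          change (φ.toEquiv.symm z : X.V) = _
          rw [h']
        · intro x y
          simpa using (φ.isometric (φ.toEquiv.symm x) (φ.toEquiv.symm y)).symm
      trans := by
        rintro X Y Z ⟨φ⟩ ⟨ψ⟩
        exact ⟨⟨φ.toEquiv.trans ψ.toEquiv,
          fun x y z s t hs ht hst hz => ψ.affine _ _ _ s t hs ht hst
            (φ.affine x y z s t hs ht hst hz),
          fun x y => by simp [ψ.isometric, φ.isometric]⟩⟩ }

/-- Affine isometric isomorphism classes of metric Bauer simplices. -/
def Class : Type (u + 1) := Quotient setoid.{u}

/-- The class of `X`. -/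
def toClass (X : MetricBauerSimplex.{u}) : Class.{u} := Quotient.mk setoid X

end MetricBauerSimplex

/-- `d` is a quasimetric with constant `C`. -/
structure IsQuasimetric {Q : Type u} (C : ℝ) (d : Q → Q → ℝ) : Prop where
  nonneg : ∀ x y, 0 ≤ d x y
  eq_zero_iff : ∀ x y, d x y = 0 ↔ x = y
  symm : ∀ x y, d x y = d y x
  quasiTriangle : ∀ x y z, d x z ≤ C * (d x y + d y z)

/-! ### Compact quantum metric spaces and the quantum Gromov--Hausdorff distance -/

/-- An extended seminorm, with values in `[0, ∞]` and the convention `0 * ∞ = 0`. -/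
structure IsExtSeminorm (𝕜 : Type u) [NormedField 𝕜] {E : Type v} [AddCommGroup E] [Module 𝕜 E]
    (L : E → ℝ≥0∞) : Prop where
  add_le : ∀ x y, L (x + y) ≤ L x + L y
  smul : ∀ (c : 𝕜) (x : E), L (c • x) = ‖c‖ₑ * L x

/-- `ρ` is finite, and its open balls form neighbourhood bases of the given topology. -/
def InducesTopology {S : Type u} [TopologicalSpace S] (ρ : S → S → ℝ≥0∞) : Prop :=
  (∀ σ τ, ρ σ τ ≠ ∞) ∧ ∀ (σ : S) (s : Set S), s ∈ 𝓝 σ ↔ ∃ ε > 0, {τ | ρ σ τ < ε} ⊆ s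

section OrderUnit

variable {E : Type u} [AddCommGroup E] [Module ℝ E] [PartialOrder E]

/-- `(E, e)` is an order unit space. -/
structure IsOrderUnitSpace (e : E) : Prop where
  add_le_add_right : ∀ x y z : E, x ≤ y → x + z ≤ y + z
  smul_nonneg : ∀ (r : ℝ) (x : E), 0 ≤ r → 0 ≤ x → 0 ≤ r • x
  exists_le : ∀ x : E, ∃ r : ℝ, x ≤ r • e
  archimedean : ∀ x : E, (∀ r : ℝ, 0 < r → x ≤ r • e) → x ≤ 0

/-- The state space `S(E)`: positive unital linear functionals. -/
def StateSpace (e : E) : Type u := {φ : E →ₗ[ℝ] ℝ // (∀ x, 0 ≤ x → 0 ≤ φ x) ∧ φ e = 1}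

/-- The `w*`-topology: pointwise convergence. -/
instance (e : E) : TopologicalSpace (StateSpace e) :=
  TopologicalSpace.induced (fun φ (x : E) => φ.1 x) inferInstance

/-- The metric `ρ_L` on the state space. -/
def stateDist (e : E) (L : E → ℝ≥0∞) (σ τ : StateSpace e) : ℝ≥0∞ :=
  ⨆ (x : E) (_ : L x ≤ 1), ENNReal.ofReal |σ.1 x - τ.1 x|

/-- `L` is a Lip-norm on `(E, e)`. -/
structure IsLipNorm (e : E) (L : E → ℝ≥0∞) : Prop where
  isExtSeminorm : IsExtSeminorm ℝ L
  eq_zero_iff : ∀ x, L x = 0 ↔ ∃ r : ℝ, x = r • e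
  inducesTopology : InducesTopology (stateDist e L)

/-- `(E, e, L)` is a compact quantum metric space. -/
structure IsCompactQuantumMetricSpace (e : E) (L : E → ℝ≥0∞) : Prop where
  isOrderUnitSpace : IsOrderUnitSpace e
  isLipNorm : IsLipNorm e L

variable {F : Type v} [AddCommGroup F] [Module ℝ F] [PartialOrder F]

/-- The embedding `S(E) → S(E ⊕ F)` dual to the first coordinate projection. -/
def StateSpace.inl (e : E) (f : F) (σ : StateSpace e) : StateSpace (e, f) :=
  ⟨σ.1.comp (LinearMap.fst ℝ E F), fun _ hx => σ.2.1 _ hx.1, σ.2.2⟩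

/-- The embedding `S(F) → S(E ⊕ F)` dual to the second coordinate projection. -/
def StateSpace.inr (e : E) (f : F) (τ : StateSpace f) : StateSpace (e, f) :=
  ⟨τ.1.comp (LinearMap.snd ℝ E F), fun _ hx => τ.2.1 _ hx.2, τ.2.2⟩

/-- `L` is an admissible Lip-norm on `E ⊕ F` (with the coordinatewise order and the order unit
`(e, f)`): its quotient seminorms on `E` and `F` are `L₁` and `L₂`. -/
structure IsAdmissible (e : E) (L₁ : E → ℝ≥0∞) (f : F) (L₂ : F → ℝ≥0∞) (L : E × F → ℝ≥0∞) :
    Prop where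
  isLipNorm : IsLipNorm (e, f) L
  quotient_left : ∀ x, L₁ x = ⨅ y : F, L (x, y)
  quotient_right : ∀ y, L₂ y = ⨅ x : E, L (x, y)

/-- The Hausdorff distance between `S(E)` and `S(F)` inside `(S(E ⊕ F), ρ_L)`. -/
def stateHausdorff (e : E) (f : F) (L : E × F → ℝ≥0∞) : ℝ≥0∞ :=
  sInf {r | 0 < r ∧
    (∀ σ : StateSpace e, ∃ τ : StateSpace f,
      stateDist (e, f) L (StateSpace.inl e f σ) (StateSpace.inr e f τ) < r) ∧
    (∀ τ : StateSpace f, ∃ σ : StateSpace e,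
      stateDist (e, f) L (StateSpace.inl e f σ) (StateSpace.inr e f τ) < r)}

/-- Rieffel's quantum Gromov--Hausdorff distance. -/
def quantumDist (e : E) (L₁ : E → ℝ≥0∞) (f : F) (L₂ : F → ℝ≥0∞) : ℝ≥0∞ :=
  ⨅ (L : E × F → ℝ≥0∞) (_ : IsAdmissible e L₁ f L₂ L), stateHausdorff e f L

end OrderUnit

/-- The quantum Gromov--Hausdorff distance between `Aff(X)` and `Aff(Y)`. -/
def MetricBauerSimplex.qdist (X Y : MetricBauerSimplex.{u}) : ℝ≥0∞ :=
  quantumDist (Aff.unit X.carrier) X.affLip (Aff.unit Y.carrier) Y.affLip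

/-! ### C*-algebraic quantum metric Choquet simplices and the quantum intertwining gap -/

section CStar

variable (A : Type u) [CStarAlgebra A]

/-- The tracial states `T(A)`, as a subset of the dual with the `w*`-topology. -/
def traces : Set (WeakDual ℂ A) :=
  {τ | τ 1 = 1 ∧ (∀ a : A, 0 ≤ τ (star a * a)) ∧ ∀ a b : A, τ (a * b) = τ (b * a)}

/-- The Cuntz--Pedersen null space `A₀`: differences `a - b` of equivalent positive elements
`a = ∑ xₙ* xₙ` and `b = ∑ xₙ xₙ*`. -/
def cpNull : Set A :=
  {c | ∃ (x : ℕ → A) (a b : A), HasSum (fun n => star (x n) * x n) a ∧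
    HasSum (fun n => x n * star (x n)) b ∧ c = a - b}

/-- `A^q = A_sa / A₀` is tracially ordered: `T(A)` is nonempty, and the class of a self-adjoint `a`
is the class of a positive element `x* x` if and only if `τ(a) ≥ 0` for all `τ ∈ T(A)`. -/
def IsTraciallyOrdered : Prop :=
  (traces A).Nonempty ∧ ∀ a : A, IsSelfAdjoint a →
    ((∃ x : A, a - star x * x ∈ cpNull A) ↔ ∀ τ ∈ traces A, 0 ≤ τ a)

variable {A}

/-- The metric `ρ_L` on `T(A)`, as a supremum in `[0, ∞]`. -/
def traceEDist (L : A → ℝ≥0∞) (σ τ : traces A) : ℝ≥0∞ :=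
  ⨆ (a : A) (_ : L a ≤ 1), ENNReal.ofReal ‖(σ : WeakDual ℂ A) a - (τ : WeakDual ℂ A) a‖

/-- The metric `ρ_L` on `T(A)`, as a real number. -/
def traceDist (L : A → ℝ≥0∞) (σ τ : traces A) : ℝ := (traceEDist L σ τ).toReal

/-- `(A, L)` is a C*-algebraic quantum metric Choquet simplex. -/
structure IsCStarQMCS (L : A → ℝ≥0∞) : Prop where
  separable : TopologicalSpace.SeparableSpace A
  isExtSeminorm : IsExtSeminorm ℂ L
  isTraciallyOrdered : IsTraciallyOrdered A
  selfAdjoint : ∀ a, L (star a) = L a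
  lowerSemicontinuous : LowerSemicontinuous L
  denselyFinite : Dense {a | L a < ∞}
  eq_zero_iff : ∀ a, L a = 0 ↔ a ∈ Submodule.span ℂ ({1} ∪ cpNull A)
  inducesTopology : InducesTopology (traceEDist L)

/-- `(A, L)` is a C*-algebraic quantum metric Bauer simplex. -/
structure IsCStarQMBS (L : A → ℝ≥0∞) : Prop extends IsCStarQMCS L where
  isMetricBauerSimplex : IsMetricBauerSimplex (traces A) (traceDist L)

/-- The quantum intertwining gap `γ_q((A, L), (B, M))`. -/
def quantumGap {B : Type v} [CStarAlgebra B] (L : A → ℝ≥0∞) (M : B → ℝ≥0∞) : ℝ≥0∞ :=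
  intertwiningGap (traces A) (traceDist L) (traces B) (traceDist M)

end CStar

end QIG

end

/-!
A metric Bauer simplex `X` is determined by the compact metric space `∂ₑX`: a continuous function
`f` on `∂ₑX` extends uniquely to a continuous affine function on `X`, namely to `x ↦ ∫ f dμₓ`
(`IsMetricBauerSimplex.affExtend`), and because the metric of `X` is a Wasserstein metric this
extension preserves Lipschitz constants (`IsMetricBauerSimplex.abs_integral_sub_le`). Together with
the fact that every state of `Aff(X)` is a point evaluation (`exists_eq_evalState`), this identifies
`X` isometrically both with the state space of `Aff(X)` and with the tracial state space of
`C(∂ₑX)` (`stateDist_evalState`, `traceIsometry`), and so yields the quantum metric structures and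
the equality of the two gaps, the gap being invariant under affine isometric isomorphism.

The gap is a quasimetric because approximate isometries compose, with a loss of at most a factor
`2`, and because a limit of `1 / (n + 1)`-isometries along an ultrafilter is an affine isometry.

For the bound by the quantum Gromov--Hausdorff distance, let `L` be an admissible Lip-norm for
which the two state spaces are at Hausdorff distance less than `r`. The points of `Y` that are
closer than `r` to a given boundary point of `X` form a nonempty convex set, so that a partition of
unity gives a continuous selection `∂ₑX → Y`, and taking barycentres extends it to a continuous
affine map `X → Y` that moves points by at most `r` (`exists_affine_selection`). This map and its
counterpart `Y → X` are approximately inverse and isometric up to `2 * r`.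

Conversely, an `ε`-isometry `f : X → Y` gives the seminorm
`max (Lip h) (Lip k) (sup |h - k ∘ f| / (5 * ε))` on `Aff(X) ⊕ Aff(Y)`. Its quotients are the
Lipschitz seminorms, since a function that is Lipschitz up to an additive error can be corrected on
the boundary by McShane's formula and then extended affinely. Hence `dist_q ≤ 7 * γ`
(`MetricBauerSimplex.qdist_le_gap`), so that `γ` and `dist_q` have the same null sequences.
-/

noncomputable section

namespace QIG

/-! ### Topologies induced by real-valued distance functions -/

/-- The function `d` is a metric inducing the given topology. -/
structure MetrizedBy {K : Type u} [TopologicalSpace K] (d : K → K → ℝ) : Prop where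
  eq_zero_iff : ∀ x y, d x y = 0 ↔ x = y
  symm : ∀ x y, d x y = d y x
  triangle : ∀ x y z, d x z ≤ d x y + d y z
  mem_nhds_iff : ∀ (x : K) (s : Set K), s ∈ 𝓝 x ↔ ∃ ε > 0, {y | d x y < ε} ⊆ s

namespace MetrizedBy

variable {K : Type u} [TopologicalSpace K] {d : K → K → ℝ}

lemma self (h : MetrizedBy d) (x : K) : d x x = 0 := (h.eq_zero_iff x x).2 rfl

lemma nonneg (h : MetrizedBy d) (x y : K) : 0 ≤ d x y := by
  have := h.triangle x y x
  rw [h.self, h.symm y x] at this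
  linarith

lemma pos (h : MetrizedBy d) {x y : K} (hxy : x ≠ y) : 0 < d x y :=
  lt_of_le_of_ne (h.nonneg x y) fun h0 => hxy ((h.eq_zero_iff x y).1 h0.symm)

/-- The bundled metric space structure; its topology is definitionally the given one. -/
abbrev metricSpace (h : MetrizedBy d) : MetricSpace K :=
  let m : MetricSpace K :=
    { dist := d
      dist_self := h.self
      dist_comm := h.symm
      dist_triangle := h.triangle
      eq_of_dist_eq_zero := fun {x y} hxy => (h.eq_zero_iff x y).1 hxy }
  m.replaceTopology <| by
    refine TopologicalSpace.ext_nhds fun x => Filter.ext fun s => ?_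
    rw [h.mem_nhds_iff, @Metric.mem_nhds_iff K m.toPseudoMetricSpace]
    have : ∀ ε, {y | d x y < ε} = @Metric.ball K m.toPseudoMetricSpace x ε := by
      intro ε; ext y
      change d x y < ε ↔ d y x < ε
      rw [h.symm]
    simp only [this]

lemma t2Space (h : MetrizedBy d) : T2Space K := by
  let := h.metricSpace
  infer_instance

lemma secondCountableTopology (h : MetrizedBy d) [CompactSpace K] :
    SecondCountableTopology K := by
  let := h.metricSpace
  infer_instance

lemma continuous_dist (h : MetrizedBy d) : Continuous fun p : K × K => d p.1 p.2 := by
  let := h.metricSpace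
  exact _root_.continuous_dist

lemma continuous_of_le (h : MetrizedBy d) {F : Type v} [PseudoMetricSpace F] {f : K → F} {C : ℝ}
    (hf : ∀ x y, dist (f x) (f y) ≤ C * d x y) : Continuous f := by
  let := h.metricSpace
  refine (LipschitzWith.of_dist_le_mul (K := C.toNNReal) fun x y => (hf x y).trans ?_).continuous
  exact mul_le_mul_of_nonneg_right (Real.le_coe_toNNReal C) (h.nonneg x y)

lemma exists_bound (h : MetrizedBy d) [CompactSpace K] : ∃ D, 0 < D ∧ ∀ x y, d x y ≤ D := by
  let := h.metricSpace
  obtain ⟨D, hD⟩ := Metric.isBounded_iff.1 (isCompact_univ (X := K)).isBounded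
  exact ⟨max D 1, by positivity, fun x y =>
    (hD (mem_univ x) (mem_univ y)).trans (le_max_left _ _)⟩

lemma lipSeminorm_le_iff (h : MetrizedBy d) {F : Type v} [NormedAddCommGroup F] {f : K → F}
    {C : ℝ} (hC : 0 ≤ C) :
    lipSeminorm d f ≤ ENNReal.ofReal C ↔ ∀ x y, ‖f x - f y‖ ≤ C * d x y := by
  simp only [lipSeminorm, iSup_le_iff, ENNReal.ofReal_le_ofReal_iff hC]
  refine ⟨fun H x y => ?_, fun H x y hxy => (div_le_iff₀ (h.pos hxy)).2 (H x y)⟩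
  rcases eq_or_ne x y with rfl | hxy
  · simp [h.self]
  · exact (div_le_iff₀ (h.pos hxy)).1 (H x y hxy)

lemma lipSeminorm_le_one_iff (h : MetrizedBy d) {F : Type v} [NormedAddCommGroup F] {f : K → F} :
    lipSeminorm d f ≤ 1 ↔ ∀ x y, ‖f x - f y‖ ≤ d x y := by
  simpa using h.lipSeminorm_le_iff (f := f) zero_le_one

lemma lipSeminorm_eq_zero_iff (h : MetrizedBy d) {F : Type v} [NormedAddCommGroup F] {f : K → F} :
    lipSeminorm d f = 0 ↔ ∀ x y, f x = f y := by
  rw [← nonpos_iff_eq_zero, ← ENNReal.ofReal_zero, h.lipSeminorm_le_iff le_rfl]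
  simp [sub_eq_zero]

end MetrizedBy

lemma lipSeminorm_add_le {K : Type u} {F : Type v} [NormedAddCommGroup F] {d : K → K → ℝ}
    (hd : ∀ x y, 0 ≤ d x y) (f g : K → F) :
    lipSeminorm d (f + g) ≤ lipSeminorm d f + lipSeminorm d g := by
  refine iSup_le fun x => iSup_le fun y => iSup_le fun hxy => ?_
  refine le_trans ?_ (add_le_add (le_iSup_of_le x <| le_iSup_of_le y <| le_iSup_of_le hxy le_rfl)
    (le_iSup_of_le x <| le_iSup_of_le y <| le_iSup_of_le hxy le_rfl))
  rw [← ENNReal.ofReal_add (div_nonneg (norm_nonneg _) (hd _ _))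
    (div_nonneg (norm_nonneg _) (hd _ _)), ← add_div]
  refine ENNReal.ofReal_le_ofReal (div_le_div_of_nonneg_right ?_ (hd _ _))
  simp only [Pi.add_apply, add_sub_add_comm]
  exact norm_add_le _ _

lemma lipSeminorm_smul {K : Type u} {𝕜 : Type*} {F : Type v} [NormedField 𝕜]
    [NormedAddCommGroup F] [NormedSpace 𝕜 F] (d : K → K → ℝ) (c : 𝕜) (f : K → F) :
    lipSeminorm d (c • f) = ‖c‖ₑ * lipSeminorm d f := by
  simp only [lipSeminorm, ENNReal.mul_iSup]
  refine iSup_congr fun x => iSup_congr fun y => iSup_congr fun _ => ?_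
  rw [Pi.smul_apply, Pi.smul_apply, ← smul_sub, norm_smul, mul_div_assoc,
    ENNReal.ofReal_mul (norm_nonneg _), ofReal_norm]

/-- The Lipschitz functions on a compact metric space, as a star subalgebra of the continuous
functions. -/
def lipStarSubalgebra (𝕜 : Type*) [RCLike 𝕜] {K : Type u} [TopologicalSpace K] [CompactSpace K]
    (d : K → K → ℝ) : StarSubalgebra 𝕜 C(K, 𝕜) where
  carrier := {f | ∃ C, ∀ x y, ‖f x - f y‖ ≤ C * d x y}
  mul_mem' := by
    rintro f g ⟨C, hC⟩ ⟨D, hD⟩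
    refine ⟨‖f‖ * D + C * ‖g‖, fun x y => ?_⟩
    have : (f * g) x - (f * g) y = f x * (g x - g y) + (f x - f y) * g y := by
      simp only [ContinuousMap.mul_apply]; ring
    rw [this]
    refine (norm_add_le _ _).trans ?_
    rw [norm_mul, norm_mul]
    have h1 := mul_le_mul (f.norm_coe_le_norm x) (hD x y) (norm_nonneg _) (norm_nonneg _)
    have h2 := mul_le_mul (hC x y) (g.norm_coe_le_norm y) (norm_nonneg _)
      ((norm_nonneg _).trans (hC x y))
    linarith
  add_mem' := by
    rintro f g ⟨C, hC⟩ ⟨D, hD⟩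
    refine ⟨C + D, fun x y => ?_⟩
    rw [ContinuousMap.add_apply, ContinuousMap.add_apply, add_sub_add_comm, add_mul]
    exact (norm_add_le _ _).trans (add_le_add (hC x y) (hD x y))
  algebraMap_mem' r := ⟨0, fun x y => by simp⟩
  star_mem' := by
    rintro f ⟨C, hC⟩
    refine ⟨C, fun x y => ?_⟩
    rw [ContinuousMap.star_apply, ContinuousMap.star_apply, ← star_sub, norm_star]
    exact hC x y

/-- Lipschitz functions are dense in the continuous functions, by the Stone--Weierstrass theorem:
the functions `x ↦ d x x₀` separate points. -/
lemma MetrizedBy.exists_lipschitz_near {𝕜 : Type*} [RCLike 𝕜] {K : Type u} [TopologicalSpace K]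
    [CompactSpace K] {d : K → K → ℝ} (h : MetrizedBy d) (f : C(K, 𝕜)) {ε : ℝ} (hε : 0 < ε) :
    ∃ g : C(K, 𝕜), (∃ C, ∀ x y, ‖g x - g y‖ ≤ C * d x y) ∧ ‖f - g‖ < ε := by
  have hsep : (lipStarSubalgebra 𝕜 d).SeparatesPoints := by
    intro x y hxy
    have hlip : ∀ a b, ‖((d a x : ℝ) : 𝕜) - ((d b x : ℝ) : 𝕜)‖ ≤ 1 * d a b := by
      intro a b
      rw [← RCLike.ofReal_sub, RCLike.norm_ofReal, abs_le, one_mul]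
      have := h.triangle a b x
      have := h.triangle b a x
      rw [h.symm b a] at this
      constructor <;> linarith
    refine ⟨_, ⟨⟨fun a => ((d a x : ℝ) : 𝕜), h.continuous_of_le (C := 1) fun a b => by
      rw [dist_eq_norm]; exact hlip a b⟩, ⟨1, hlip⟩, rfl⟩, ?_⟩
    simp only [ContinuousMap.coe_mk, ne_eq, RCLike.ofReal_inj, h.self]
    exact (h.pos hxy.symm).ne
  have htop := ContinuousMap.starSubalgebra_topologicalClosure_eq_top_of_separatesPoints _ hsep
  have hf : f ∈ (lipStarSubalgebra 𝕜 d).topologicalClosure := by rw [htop]; trivial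
  obtain ⟨g, hg, hfg⟩ := Metric.mem_closure_iff.1 hf ε hε
  exact ⟨g, hg, by rwa [dist_eq_norm] at hfg⟩

/-- McShane's extension formula, used to correct a function that is `t`-Lipschitz up to an additive
error. -/
lemma MetrizedBy.exists_lipschitz_of_le_add {K : Type u} [TopologicalSpace K] {d : K → K → ℝ}
    (h : MetrizedBy d) {u : K → ℝ} {t δ : ℝ} (ht : 0 ≤ t)
    (hu : ∀ x y, u x - u y ≤ t * d x y + δ) :
    ∃ v : K → ℝ, (∀ x y, |v x - v y| ≤ t * d x y) ∧ ∀ x, |v x - u x| ≤ δ := by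
  have hbdd : ∀ x, BddBelow (range fun y => u y + t * d x y) := by
    intro x
    refine ⟨u x - δ, ?_⟩
    rintro _ ⟨y, rfl⟩
    have := hu x y
    dsimp only
    linarith
  have hlip : ∀ x y, (⨅ z, u z + t * d x z) ≤ (⨅ z, u z + t * d y z) + t * d x y := by
    intro x y
    have : Nonempty K := ⟨x⟩
    rw [← sub_le_iff_le_add]
    refine le_ciInf fun z => ?_
    have h1 := ciInf_le (hbdd x) z
    have h2 := mul_le_mul_of_nonneg_left (h.triangle x y z) ht
    linarith
  refine ⟨fun x => ⨅ y, u y + t * d x y, fun x y => ?_, fun x => ?_⟩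
  · have h1 := hlip x y
    have h2 := hlip y x
    rw [h.symm y x] at h2
    exact abs_le.2 ⟨by linarith, by linarith⟩
  · have : Nonempty K := ⟨x⟩
    have h1 : (⨅ y, u y + t * d x y) ≤ u x := by
      simpa [h.self] using ciInf_le (hbdd x) x
    have h2 : u x - δ ≤ ⨅ y, u y + t * d x y := le_ciInf fun y => by
      have := hu x y
      linarith
    have h3 := hu x x
    rw [h.self] at h3
    exact abs_le.2 ⟨by linarith, by linarith⟩

/-- A distance function on `S` induces the topology of `S` as soon as it is continuous along a
continuous surjection from a compact space. -/
lemma inducesTopology_of_surjective {P : Type u} [TopologicalSpace P] [CompactSpace P]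
    {S : Type v} [TopologicalSpace S] [T2Space S] {π : P → S} (hπ : Continuous π)
    (hsurj : Function.Surjective π) {ρ : S → S → ℝ≥0∞} (hfin : ∀ σ τ, ρ σ τ ≠ ∞)
    (heq : ∀ σ τ, ρ σ τ = 0 ↔ σ = τ) (hsymm : ∀ σ τ, ρ σ τ = ρ τ σ)
    (htri : ∀ σ τ υ, ρ σ υ ≤ ρ σ τ + ρ τ υ)
    (hlim : ∀ p, Tendsto (fun q => ρ (π p) (π q)) (𝓝 p) (𝓝 0)) : InducesTopology ρ := by
  have hcont : ∀ σ, Continuous fun q => ρ σ (π q) := by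
    intro σ
    refine continuous_iff_continuousAt.2 fun p => ?_
    refine (ENNReal.tendsto_nhds (hfin _ _)).2 fun ε hε => ?_
    filter_upwards [(hlim p).eventually (gt_mem_nhds hε)] with q hq
    refine ⟨tsub_le_iff_right.2 ((htri _ (π q) _).trans ?_), (htri _ (π p) _).trans ?_⟩
    · rw [hsymm (π q)]
      gcongr
    · gcongr
  refine ⟨hfin, fun σ s => ⟨fun hs => ?_, ?_⟩⟩
  · obtain ⟨U, hUs, hU, hσ⟩ := mem_nhds_iff.1 hs
    have hcomp : IsCompact (π ⁻¹' Uᶜ) := (hU.isClosed_compl.preimage hπ).isCompact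
    rcases (π ⁻¹' Uᶜ).eq_empty_or_nonempty with he | hne
    · refine ⟨1, one_pos, fun τ _ => hUs ?_⟩
      obtain ⟨p, rfl⟩ := hsurj τ
      by_contra hp
      exact (he ▸ hp : p ∈ (∅ : Set P))
    · obtain ⟨p, hp, hmin⟩ := hcomp.exists_isMinOn hne (hcont σ).continuousOn
      refine ⟨ρ σ (π p), pos_iff_ne_zero.2 fun h0 => hp ?_, fun τ hτ => hUs ?_⟩
      · rwa [← (heq _ _).1 h0]
      · obtain ⟨q, rfl⟩ := hsurj τ
        by_contra hq
        exact (lt_of_lt_of_le (mem_ofPred.1 hτ) (mem_ofPred.1 (hmin hq))).false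
  · rintro ⟨ε, hε, hs⟩
    have hopen : IsOpen {τ | ρ σ τ < ε} := by
      rw [← (Topology.IsQuotientMap.of_surjective_continuous hsurj hπ).isOpen_preimage]
      exact isOpen_lt (hcont σ) continuous_const
    exact mem_of_superset (hopen.mem_nhds (by simpa [(heq σ σ).2 rfl] using hε)) hs

/-- The special case of an isometric parametrization by a compact metric space. -/
lemma MetrizedBy.inducesTopology {P : Type u} [TopologicalSpace P] [CompactSpace P]
    {d : P → P → ℝ} (hd : MetrizedBy d) {S : Type v} [TopologicalSpace S] [T2Space S] {π : P → S}
    (hπ : Continuous π) (hsurj : Function.Surjective π) {ρ : S → S → ℝ≥0∞}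
    (hρ : ∀ p q, ρ (π p) (π q) = ENNReal.ofReal (d p q)) : InducesTopology ρ := by
  refine inducesTopology_of_surjective hπ hsurj ?_ ?_ ?_ ?_ ?_
  · refine hsurj.forall₂.2 fun p q => ?_
    rw [hρ]
    exact ENNReal.ofReal_ne_top
  · refine hsurj.forall₂.2 fun p q => ⟨fun h => ?_, fun h => ?_⟩
    · rw [hρ, ENNReal.ofReal_eq_zero] at h
      rw [(hd.eq_zero_iff p q).1 (le_antisymm h (hd.nonneg p q))]
    · rw [← h, hρ, hd.self, ENNReal.ofReal_zero]
  · exact hsurj.forall₂.2 fun p q => by rw [hρ, hρ, hd.symm]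
  · refine hsurj.forall₃.2 fun p q r => ?_
    rw [hρ, hρ, hρ, ← ENNReal.ofReal_add (hd.nonneg _ _) (hd.nonneg _ _)]
    exact ENNReal.ofReal_le_ofReal (hd.triangle p q r)
  · intro p
    simp only [hρ]
    have h : Continuous fun q => ENNReal.ofReal (d p q) :=
      ENNReal.continuous_ofReal.comp
        (hd.continuous_dist.comp (continuous_const.prodMk continuous_id))
    simpa [hd.self] using h.tendsto p

/-! ### Representing measures and affine functions on a metric Bauer simplex -/

section Bauer

variable {V : Type u} [AddCommGroup V] [Module ℝ V] [TopologicalSpace V] {X : Set V}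
  {d : X → X → ℝ}

lemma Boundary.isEmbedding_incl : Topology.IsEmbedding (Boundary.incl (X := X)) := by
  have h1 : Continuous (Boundary.incl (X := X)) :=
    Continuous.subtype_mk (f := fun e : Boundary X => e.1) continuous_subtype_val _
  have h2 : Topology.IsEmbedding ((Subtype.val : X → V) ∘ Boundary.incl (X := X)) :=
    Topology.IsEmbedding.subtypeVal (p := fun v => v ∈ X.extremePoints ℝ)
  exact Topology.IsEmbedding.of_comp h1 continuous_subtype_val h2

lemma Boundary.continuous_incl : Continuous (Boundary.incl (X := X)) :=
  Boundary.isEmbedding_incl.continuous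

/-- The restriction of a continuous affine function to the extremal boundary. -/
def Aff.restrict (h : Aff X) : C(Boundary X, ℝ) := ⟨fun e => h.1 e.incl, by
  exact h.1.continuous.comp Boundary.continuous_incl⟩

lemma Aff.map_mem (h : Aff X) {x y z : X} {s t : ℝ} (hs : 0 ≤ s) (ht : 0 ≤ t) (hst : s + t = 1)
    (hz : (z : V) = s • (x : V) + t • (y : V)) : h.1 z = s * h.1 x + t * h.1 y := by
  simpa using h.2 x y z s t hs ht hst hz

/-- Evaluation at a point of `X`, as a state of `Aff(X)`. -/
def evalState (x : X) : StateSpace (Aff.unit X) :=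
  ⟨{ toFun := fun h => h.1 x
     map_add' := fun _ _ => rfl
     map_smul' := fun _ _ => rfl }, fun _ hh => hh x, rfl⟩

lemma Aff.exists_smul_unit_le [CompactSpace X] (h : Aff X) : ∃ r : ℝ, h ≤ r • Aff.unit X :=
  ⟨‖h.1‖, fun x => by
    simpa [Aff.unit] using (le_abs_self _).trans (h.1.norm_coe_le_norm x)⟩

/-- Every state of `Aff(X)` is a point evaluation: otherwise, by compactness, finitely many affine
functions already distinguish it from all point evaluations, and a separating functional in a
finite-dimensional space contradicts positivity. -/
lemma exists_eq_evalState (hc : IsCompact X) (hconv : Convex ℝ X)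
    (φ : StateSpace (Aff.unit X)) : ∃ x : X, φ = evalState x := by
  have : CompactSpace X := isCompact_iff_compactSpace.1 hc
  suffices H : ∃ x : X, ∀ h : Aff X, h.1 x = φ.1 h by
    obtain ⟨x, hx⟩ := H
    exact ⟨x, Subtype.ext (LinearMap.ext fun h => (hx h).symm)⟩
  classical
  by_contra! hcon
  obtain ⟨u, hu⟩ := isCompact_univ.elim_finite_subfamily_closed
    (fun h : Aff X => {x : X | h.1 x = φ.1 h})
    (fun h => isClosed_eq h.1.continuous continuous_const) (by
      refine eq_empty_of_forall_notMem fun x hx => ?_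
      obtain ⟨h, hh⟩ := hcon x
      exact hh (mem_iInter.1 hx.2 h))
  let Φ : X → (u → ℝ) := fun x i => i.1.1 x
  have hΦ : Continuous Φ := continuous_pi fun i => i.1.1.continuous
  have hcv : Convex ℝ (range Φ) := by
    rintro _ ⟨x, rfl⟩ _ ⟨y, rfl⟩ s t hs ht hst
    refine ⟨⟨s • x.1 + t • y.1, hconv x.2 y.2 hs ht hst⟩, funext fun i => ?_⟩
    exact Aff.map_mem i.1 hs ht hst rfl
  have hp : (fun i : u => φ.1 i.1) ∉ range Φ := by
    rintro ⟨x, hx⟩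
    have : x ∈ univ ∩ ⋂ i ∈ u, {x : X | i.1 x = φ.1 i} :=
      ⟨trivial, mem_iInter₂.2 fun i hi => congrFun hx ⟨i, hi⟩⟩
    rw [hu] at this
    exact this
  obtain ⟨f, c, hfc, hcf⟩ := geometric_hahn_banach_point_closed hcv
    (isCompact_range hΦ).isClosed hp
  have hsum : ∀ w : u → ℝ, f w = ∑ i, w i * f (fun j => if i = j then 1 else 0) := fun w =>
    f.toLinearMap.pi_apply_eq_sum_univ w
  let H : Aff X := ∑ i : u, f (fun j => if i = j then 1 else 0) • i.1
  have hHφ : φ.1 H = f fun i : u => φ.1 i.1 := by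
    rw [hsum, map_sum]
    exact Finset.sum_congr rfl fun i _ => by rw [map_smul, smul_eq_mul, mul_comm]
  have hHx : ∀ x, H.1 x = f (Φ x) := by
    intro x
    change (evalState x).1 H = _
    rw [hsum, map_sum]
    exact Finset.sum_congr rfl fun i _ => by rw [map_smul, smul_eq_mul, mul_comm]; rfl
  have hpos : 0 ≤ φ.1 (H - c • Aff.unit X) := φ.2.1 _ fun x => by
    have := hcf (Φ x) ⟨x, rfl⟩
    rw [← hHx] at this
    simpa [Aff.unit] using this.le
  rw [map_sub, map_smul, φ.2.2, hHφ, smul_eq_mul, mul_one] at hpos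
  linarith

namespace IsCompactConvexMetric

lemma metrizedBy (h : IsCompactConvexMetric X d) : MetrizedBy d :=
  ⟨h.eq_zero_iff, h.symm, h.triangle, h.mem_nhds_iff⟩

lemma compactSpace (h : IsCompactConvexMetric X d) : CompactSpace X :=
  isCompact_iff_compactSpace.1 h.isCompact

lemma metrizedBy_boundary (h : IsCompactConvexMetric X d) :
    MetrizedBy fun e e' : Boundary X => d e.incl e'.incl where
  eq_zero_iff e e' := (h.eq_zero_iff _ _).trans Boundary.isEmbedding_incl.injective.eq_iff
  symm _ _ := h.symm _ _
  triangle _ _ _ := h.triangle _ _ _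
  mem_nhds_iff e s := by
    rw [Boundary.isEmbedding_incl.isInducing.nhds_eq_comap, mem_comap]
    constructor
    · rintro ⟨t, ht, hts⟩
      obtain ⟨ε, hε, h'⟩ := (h.mem_nhds_iff _ _).1 ht
      exact ⟨ε, hε, fun y hy => hts (h' hy)⟩
    · rintro ⟨ε, hε, h'⟩
      exact ⟨_, (h.mem_nhds_iff _ _).2 ⟨ε, hε, subset_rfl⟩, h'⟩

end IsCompactConvexMetric

namespace IsMetricBauerSimplex

lemma compactSpace_boundary (hX : IsMetricBauerSimplex X d) : CompactSpace (Boundary X) :=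
  isCompact_iff_compactSpace.mp hX.isCompact_extremePoints

lemma integrable (hX : IsMetricBauerSimplex X d) {F : Type*} [NormedAddCommGroup F]
    [SecondCountableTopology F] {f : Boundary X → F} (hf : Continuous f)
    (μ : ProbabilityMeasure (Boundary X)) : Integrable f (μ : Measure (Boundary X)) := by
  have := hX.compactSpace_boundary
  exact hf.integrable_of_hasCompactSupport (HasCompactSupport.of_compactSpace f)

/-- The probability measure on the extremal boundary that represents `x`. -/
def reprMeasure (hX : IsMetricBauerSimplex X d) (x : X) : ProbabilityMeasure (Boundary X) :=
  (hX.existsUnique_represents x).choose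

lemma represents_reprMeasure (hX : IsMetricBauerSimplex X d) (x : X) :
    Represents (hX.reprMeasure x) x :=
  (hX.existsUnique_represents x).choose_spec.1

lemma eq_reprMeasure (hX : IsMetricBauerSimplex X d) {x : X} {μ : ProbabilityMeasure (Boundary X)}
    (hμ : Represents μ x) : μ = hX.reprMeasure x :=
  (hX.existsUnique_represents x).choose_spec.2 μ hμ

lemma integral_reprMeasure_incl (hX : IsMetricBauerSimplex X d) {F : Type*} [NormedAddCommGroup F]
    [NormedSpace ℝ F] [CompleteSpace F] (f : Boundary X → F) (e : Boundary X) :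
    ∫ e', f e' ∂(hX.reprMeasure e.incl : Measure (Boundary X)) = f e := by
  have := hX.metrizedBy_boundary.t2Space
  have h : (⟨Measure.dirac e, inferInstance⟩ : ProbabilityMeasure (Boundary X)) =
      hX.reprMeasure e.incl := hX.eq_reprMeasure fun f =>
        (integral_dirac (fun e' : Boundary X => f.1 e'.incl) e).symm
  rw [← h]
  exact integral_dirac _ _

lemma integral_combo (hX : IsMetricBauerSimplex X d) {F : Type*}
    [NormedAddCommGroup F] [NormedSpace ℝ F] [SecondCountableTopology F]
    {f : Boundary X → F} (hf : Continuous f) {μ ν : ProbabilityMeasure (Boundary X)} {s t : ℝ}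
    (hs : 0 ≤ s) (ht : 0 ≤ t) :
    ∫ e, f e ∂(ENNReal.ofReal s • (μ : Measure (Boundary X)) +
      ENNReal.ofReal t • (ν : Measure (Boundary X))) =
      s • ∫ e, f e ∂(μ : Measure (Boundary X)) + t • ∫ e, f e ∂(ν : Measure (Boundary X)) := by
  rw [integral_add_measure ((hX.integrable hf _).smul_measure ENNReal.ofReal_ne_top)
    ((hX.integrable hf _).smul_measure ENNReal.ofReal_ne_top), integral_smul_measure,
    integral_smul_measure, ENNReal.toReal_ofReal hs, ENNReal.toReal_ofReal ht]

/-- The representing measure depends affinely on the point, by uniqueness. -/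
lemma integral_reprMeasure_combo (hX : IsMetricBauerSimplex X d) {F : Type*}
    [NormedAddCommGroup F] [NormedSpace ℝ F] [SecondCountableTopology F]
    {f : Boundary X → F} (hf : Continuous f) {x y z : X} {s t : ℝ}
    (hs : 0 ≤ s) (ht : 0 ≤ t) (hst : s + t = 1) (hz : (z : V) = s • (x : V) + t • (y : V)) :
    ∫ e, f e ∂(hX.reprMeasure z : Measure (Boundary X)) =
      s • ∫ e, f e ∂(hX.reprMeasure x : Measure (Boundary X)) +
        t • ∫ e, f e ∂(hX.reprMeasure y : Measure (Boundary X)) := by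
  let ν : Measure (Boundary X) := ENNReal.ofReal s • (hX.reprMeasure x : Measure (Boundary X)) +
    ENNReal.ofReal t • (hX.reprMeasure y : Measure (Boundary X))
  have hprob : IsProbabilityMeasure ν := ⟨by
    simp [ν, ← ENNReal.ofReal_add hs ht, hst]⟩
  have hrep : Represents ⟨ν, hprob⟩ z := by
    intro h
    rw [Aff.map_mem h hs ht hst hz, hX.represents_reprMeasure x h, hX.represents_reprMeasure y h]
    exact (hX.integral_combo (Aff.restrict h).continuous hs ht).symm
  rw [← hX.eq_reprMeasure hrep]
  exact hX.integral_combo hf hs ht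

/-- Integrating a Lipschitz function against representing measures gives a Lipschitz function with
the same constant, because the metric is a Wasserstein metric. -/
lemma abs_integral_sub_le (hX : IsMetricBauerSimplex X d) {f : Boundary X → ℝ} {C : ℝ}
    (hC : 0 ≤ C) (hf : ∀ e e', |f e - f e'| ≤ C * d e.incl e'.incl) (x y : X) :
    |(∫ e, f e ∂(hX.reprMeasure x : Measure (Boundary X))) -
      ∫ e, f e ∂(hX.reprMeasure y : Measure (Boundary X))| ≤ C * d x y := by
  rcases hC.eq_or_lt with rfl | hC
  · obtain ⟨e₀⟩ := (hX.reprMeasure x).nonempty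
    have : f = fun _ => f e₀ := funext fun e => by
      simpa [sub_eq_zero] using hf e e₀
    rw [this]
    simp
  · have h1 : ∀ e e', |C⁻¹ * f e - C⁻¹ * f e'| ≤ d e.incl e'.incl := by
      intro e e'
      rw [← mul_sub, abs_mul, abs_of_pos (inv_pos.2 hC), inv_mul_le_iff₀ hC]
      exact hf e e'
    have h2 : ENNReal.ofReal |(∫ e, C⁻¹ * f e ∂(hX.reprMeasure x : Measure (Boundary X))) -
        ∫ e, C⁻¹ * f e ∂(hX.reprMeasure y : Measure (Boundary X))| ≤ ENNReal.ofReal (d x y) := by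
      rw [hX.dist_eq_wasserstein x y _ _ (hX.represents_reprMeasure x)
        (hX.represents_reprMeasure y)]
      exact le_iSup₂_of_le (fun e => C⁻¹ * f e) h1 le_rfl
    rw [ENNReal.ofReal_le_ofReal_iff (hX.metrizedBy.nonneg x y), integral_const_mul,
      integral_const_mul, ← mul_sub, abs_mul, abs_of_pos (inv_pos.2 hC), inv_mul_le_iff₀ hC] at h2
    exact h2

lemma norm_integral_sub_integral_le (hX : IsMetricBauerSimplex X d) {F : Type*}
    [NormedAddCommGroup F] [NormedSpace ℝ F] [SecondCountableTopology F] {f g : Boundary X → F}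
    (hf : Continuous f) (hg : Continuous g) {δ : ℝ} (hfg : ∀ e, ‖f e - g e‖ ≤ δ)
    (μ : ProbabilityMeasure (Boundary X)) :
    ‖(∫ e, f e ∂(μ : Measure (Boundary X))) - ∫ e, g e ∂(μ : Measure (Boundary X))‖ ≤ δ := by
  rw [← integral_sub (hX.integrable hf μ) (hX.integrable hg μ)]
  simpa using norm_integral_le_of_norm_le_const (μ := (μ : Measure (Boundary X)))
    (Eventually.of_forall hfg)

lemma continuous_integral_reprMeasure (hX : IsMetricBauerSimplex X d) (f : C(Boundary X, ℝ)) :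
    Continuous fun x => ∫ e, f e ∂(hX.reprMeasure x : Measure (Boundary X)) := by
  have := hX.compactSpace_boundary
  refine continuous_of_uniform_approx_of_continuous fun U hU => ?_
  obtain ⟨ε, hε, hεU⟩ := Metric.mem_uniformity_dist.1 hU
  obtain ⟨g, ⟨C, hC⟩, hfg⟩ := hX.metrizedBy_boundary.exists_lipschitz_near f (half_pos hε)
  refine ⟨fun x => ∫ e, g e ∂(hX.reprMeasure x : Measure (Boundary X)), ?_, fun x => hεU ?_⟩
  · refine hX.metrizedBy.continuous_of_le (C := max C 0) fun x y => ?_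
    refine hX.abs_integral_sub_le (le_max_right _ _) (fun e e' => (hC e e').trans ?_) x y
    exact mul_le_mul_of_nonneg_right (le_max_left _ _) (hX.metrizedBy.nonneg _ _)
  · rw [dist_eq_norm]
    refine (hX.norm_integral_sub_integral_le f.continuous g.continuous (δ := ε / 2)
      (fun e => ?_) _).trans_lt (half_lt_self hε)
    exact ((f - g).norm_coe_le_norm e).trans hfg.le

/-- The continuous affine extension `x ↦ ∫ f dμₓ` of a continuous function on the extremal
boundary. -/
def affExtend (hX : IsMetricBauerSimplex X d) (f : C(Boundary X, ℝ)) : Aff X :=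
  ⟨⟨fun x => ∫ e, f e ∂(hX.reprMeasure x : Measure (Boundary X)),
    hX.continuous_integral_reprMeasure f⟩,
    fun _ _ _ _ _ hs ht hst hz => hX.integral_reprMeasure_combo f.continuous hs ht hst hz⟩

lemma affExtend_apply (hX : IsMetricBauerSimplex X d) (f : C(Boundary X, ℝ)) (x : X) :
    (hX.affExtend f).1 x = ∫ e, f e ∂(hX.reprMeasure x : Measure (Boundary X)) := rfl

/-- A Lipschitz function on the extremal boundary extends to an affine Lipschitz function. -/
lemma exists_aff_of_lipschitz (hX : IsMetricBauerSimplex X d) {f : Boundary X → ℝ} {C : ℝ}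
    (hC : 0 ≤ C) (hf : ∀ e e', |f e - f e'| ≤ C * d e.incl e'.incl) :
    ∃ h : Aff X, (∀ x y, |h.1 x - h.1 y| ≤ C * d x y) ∧
      ∀ x, h.1 x = ∫ e, f e ∂(hX.reprMeasure x : Measure (Boundary X)) :=
  ⟨hX.affExtend ⟨f, hX.metrizedBy_boundary.continuous_of_le hf⟩,
    hX.abs_integral_sub_le hC hf, fun _ => rfl⟩

/-- The metric is the supremum of the oscillations of the affine `1`-Lipschitz functions. -/
lemma dist_le_of_forall (hX : IsMetricBauerSimplex X d) {x y : X} {C : ℝ}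
    (H : ∀ h : Aff X, (∀ x y, |h.1 x - h.1 y| ≤ d x y) → |h.1 x - h.1 y| ≤ C) : d x y ≤ C := by
  have hC : 0 ≤ C := by simpa using H 0 fun x y => by simpa using hX.metrizedBy.nonneg x y
  rw [← ENNReal.ofReal_le_ofReal_iff hC, hX.dist_eq_wasserstein x y _ _
    (hX.represents_reprMeasure x) (hX.represents_reprMeasure y)]
  refine iSup₂_le fun f hf => ENNReal.ofReal_le_ofReal ?_
  obtain ⟨h, hh, heq⟩ := hX.exists_aff_of_lipschitz zero_le_one
    (f := f) fun e e' => by simpa using hf e e'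
  rw [← heq, ← heq]
  exact H h fun x y => by simpa using hh x y

lemma ext_aff (hX : IsMetricBauerSimplex X d) {x y : X} (H : ∀ h : Aff X, h.1 x = h.1 y) :
    x = y := by
  refine (hX.eq_zero_iff x y).1 (le_antisymm ?_ (hX.metrizedBy.nonneg x y))
  exact hX.dist_le_of_forall fun h _ => by simp [H h]

end IsMetricBauerSimplex

end Bauer

/-! ### `Aff(X)` as a compact quantum metric space -/

section StateSpace

variable {E : Type u} [AddCommGroup E] [Module ℝ E] [PartialOrder E] {e : E} {L : E → ℝ≥0∞}

lemma StateSpace.continuous_iff {P : Type*} [TopologicalSpace P] {π : P → StateSpace e} :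
    Continuous π ↔ ∀ x, Continuous fun p => (π p).1 x := by
  rw [continuous_induced_rng, continuous_pi_iff]
  rfl

instance : T2Space (StateSpace e) :=
  T2Space.of_injective_continuous (f := fun (φ : StateSpace e) (x : E) => φ.1 x)
    (fun _ _ h => Subtype.ext (LinearMap.ext fun x => congrFun h x)) continuous_induced_dom

lemma stateDist_le_iff {σ τ : StateSpace e} {C : ℝ} (hC : 0 ≤ C) :
    stateDist e L σ τ ≤ ENNReal.ofReal C ↔ ∀ x, L x ≤ 1 → |σ.1 x - τ.1 x| ≤ C := by
  simp only [stateDist, iSup_le_iff, ENNReal.ofReal_le_ofReal_iff hC]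

lemma stateDist_self (σ : StateSpace e) : stateDist e L σ σ = 0 := by
  simp [stateDist]

lemma stateDist_comm (σ τ : StateSpace e) : stateDist e L σ τ = stateDist e L τ σ := by
  simp only [stateDist, abs_sub_comm]

lemma stateDist_triangle (σ τ υ : StateSpace e) :
    stateDist e L σ υ ≤ stateDist e L σ τ + stateDist e L τ υ := by
  refine iSup₂_le fun x hx => ?_
  refine le_trans ?_ (add_le_add (le_iSup₂_of_le x hx le_rfl) (le_iSup₂_of_le x hx le_rfl))
  rw [← ENNReal.ofReal_add (abs_nonneg _) (abs_nonneg _)]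
  exact ENNReal.ofReal_le_ofReal (abs_sub_le _ _ _)

lemma abs_sub_le_of_stateDist_le {σ τ : StateSpace e} {C : ℝ} (hC : 0 ≤ C)
    (h : stateDist e L σ τ ≤ ENNReal.ofReal C) {x : E} (hx : L x ≤ 1) : |σ.1 x - τ.1 x| ≤ C :=
  (stateDist_le_iff hC).1 h x hx

end StateSpace

section Aff

variable {V : Type u} [AddCommGroup V] [Module ℝ V] [TopologicalSpace V] {X : Set V}
  {d : X → X → ℝ}

/-- The Lipschitz seminorm on `Aff(X)`. -/
abbrev affSeminorm (d : X → X → ℝ) (h : Aff X) : ℝ≥0∞ := lipSeminorm d h.1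

lemma continuous_evalState : Continuous (evalState (X := X)) :=
  StateSpace.continuous_iff.2 fun h => h.1.continuous

lemma Aff.isOrderUnitSpace [CompactSpace X] : IsOrderUnitSpace (Aff.unit X) where
  add_le_add_right f g h hfg x := add_le_add_left (hfg x) (h.1 x)
  smul_nonneg r f hr hf x := mul_nonneg hr (hf x)
  exists_le := Aff.exists_smul_unit_le
  archimedean f hf x := le_of_forall_pos_le_add fun r hr => by
    simpa [Aff.unit] using hf r hr x

lemma MetrizedBy.isExtSeminorm_affSeminorm (h : MetrizedBy d) :
    IsExtSeminorm ℝ (affSeminorm d) where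
  add_le f g := lipSeminorm_add_le h.nonneg f.1 g.1
  smul c f := lipSeminorm_smul d c f.1

lemma IsCompactConvexMetric.affSeminorm_eq_zero_iff (h : IsCompactConvexMetric X d) (f : Aff X) :
    affSeminorm d f = 0 ↔ ∃ r : ℝ, f = r • Aff.unit X := by
  rw [h.metrizedBy.lipSeminorm_eq_zero_iff]
  constructor
  · obtain ⟨x₀, hx₀⟩ := h.nonempty
    intro hf
    refine ⟨f.1 ⟨x₀, hx₀⟩, Subtype.ext (ContinuousMap.ext fun x => ?_)⟩
    simpa [Aff.unit] using hf x ⟨x₀, hx₀⟩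
  · rintro ⟨r, rfl⟩ x y
    rfl

namespace IsMetricBauerSimplex

/-- The identification of `X` with the state space of `Aff(X)` is isometric. -/
lemma stateDist_evalState (hX : IsMetricBauerSimplex X d) (x y : X) :
    stateDist (Aff.unit X) (affSeminorm d) (evalState x) (evalState y) =
      ENNReal.ofReal (d x y) := by
  have hd := hX.metrizedBy
  have hle : stateDist (Aff.unit X) (affSeminorm d) (evalState x) (evalState y) ≤
      ENNReal.ofReal (d x y) :=
    (stateDist_le_iff (hd.nonneg x y)).2 fun h hh => hd.lipSeminorm_le_one_iff.1 hh x y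
  refine le_antisymm hle ?_
  refine ENNReal.ofReal_le_of_le_toReal (hX.dist_le_of_forall fun h hh => ?_)
  exact abs_sub_le_of_stateDist_le ENNReal.toReal_nonneg
    (ENNReal.ofReal_toReal (hle.trans_lt ENNReal.ofReal_lt_top).ne).ge
    (σ := evalState x) (τ := evalState y) (hd.lipSeminorm_le_one_iff.2 hh)

lemma isLipNorm_affSeminorm (hX : IsMetricBauerSimplex X d) :
    IsLipNorm (Aff.unit X) (affSeminorm d) where
  isExtSeminorm := hX.metrizedBy.isExtSeminorm_affSeminorm
  eq_zero_iff := hX.affSeminorm_eq_zero_iff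
  inducesTopology := by
    have := hX.compactSpace
    have hsurj : Function.Surjective (evalState (X := X)) := fun φ =>
      (exists_eq_evalState hX.isCompact hX.convex φ).imp fun _ h => h.symm
    exact hX.metrizedBy.inducesTopology continuous_evalState hsurj hX.stateDist_evalState

/-- `X` is topologically embedded in the dual of `Aff(X)`. -/
lemma continuous_of_forall_aff (hX : IsMetricBauerSimplex X d) {P : Type*} [TopologicalSpace P]
    {f : P → X} (hf : ∀ h : Aff X, Continuous fun p => h.1 (f p)) : Continuous f := by
  have := hX.compactSpace
  have hemb : Topology.IsEmbedding (evalState (X := X)) :=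
    (continuous_evalState.isClosedEmbedding fun x y hxy => hX.ext_aff fun h =>
      congrArg (fun σ : StateSpace (Aff.unit X) => σ.1 h) hxy).isEmbedding
  exact hemb.continuous_iff.2 (StateSpace.continuous_iff.2 hf)

/-- A map into `X` is affine if its compositions with continuous affine functions are. -/
lemma isAffine_of_forall_aff (hX : IsMetricBauerSimplex X d) {W : Type v} [AddCommGroup W]
    [Module ℝ W] {Y : Set W} {f : Y → X} (hf : ∀ h : Aff X, IsAffine fun y => h.1 (f y)) :
    IsAffine fun y => (f y : V) := by
  intro x y z s t hs ht hst hz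
  have : f z = ⟨s • (f x : V) + t • (f y : V), hX.convex (f x).2 (f y).2 hs ht hst⟩ :=
    hX.ext_aff fun h => (hf h x y z s t hs ht hst hz).trans (Aff.map_mem h hs ht hst rfl).symm
  exact congrArg Subtype.val this

end IsMetricBauerSimplex

end Aff

/-! ### The intertwining gap as a quasimetric -/

section Gap

universe u₁ u₂ u₃ u₄

variable {V₁ : Type u₁} [AddCommGroup V₁] [Module ℝ V₁] {X : Set V₁} {dX : X → X → ℝ}
  {V₂ : Type u₂} [AddCommGroup V₂] [Module ℝ V₂] {Y : Set V₂} {dY : Y → Y → ℝ}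
  {V₃ : Type u₃} [AddCommGroup V₃] [Module ℝ V₃] {Z : Set V₃} {dZ : Z → Z → ℝ}
  {V₄ : Type u₄} [AddCommGroup V₄] [Module ℝ V₄] {Z' : Set V₄} {dZ' : Z' → Z' → ℝ}

lemma IsAffine.comp {f : X → Y} {g : Y → Z} (hg : IsAffine fun y => (g y : V₃))
    (hf : IsAffine fun x => (f x : V₂)) : IsAffine fun x => (g (f x) : V₃) :=
  fun x y z s t hs ht hst hz => hg _ _ _ s t hs ht hst (hf x y z s t hs ht hst hz)

lemma isAffine_const (y : Y) : IsAffine fun _ : X => (y : V₂) := by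
  intro _ _ _ s t _ _ hst _
  rw [← add_smul, hst, one_smul]

/-- The inverse of an affine isometric isomorphism. -/
def AffineIsometry.symm (φ : AffineIsometry X dX Y dY) (hX : Convex ℝ X) :
    AffineIsometry Y dY X dX where
  toEquiv := φ.toEquiv.symm
  affine x y z s t hs ht hst hz := by
    have h := φ.affine (φ.toEquiv.symm x) (φ.toEquiv.symm y)
      ⟨_, hX (φ.toEquiv.symm x).2 (φ.toEquiv.symm y).2 hs ht hst⟩ s t hs ht hst rfl
    simp only [Equiv.apply_symm_apply, ← hz] at h
    exact congrArg Subtype.val ((Equiv.symm_apply_eq _).2 (Subtype.ext h).symm)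
  isometric x y := by
    simpa using (φ.isometric (φ.toEquiv.symm x) (φ.toEquiv.symm y)).symm

variable [TopologicalSpace V₁] [TopologicalSpace V₂] [TopologicalSpace V₃] [TopologicalSpace V₄]

lemma AffineIsometry.continuous (φ : AffineIsometry X dX Y dY) (hX : MetrizedBy dX)
    (hY : MetrizedBy dY) : Continuous φ.toEquiv := by
  let := hY.metricSpace
  refine hX.continuous_of_le (C := 1) fun x y => ?_
  rw [one_mul]
  exact (φ.isometric x y).le

lemma epsIsom_mono {ε ε' : ℝ} (h : ε ≤ ε') : epsIsom ε X dX Y dY ⊆ epsIsom ε' X dX Y dY := by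
  rintro f ⟨hc, ha, hi, g, hgc, hga, hg⟩
  exact ⟨hc, ha, fun x y => (hi x y).trans_le h, g, hgc, hga, fun y => (hg y).trans_le h⟩

/-- Approximate isometries compose, with constant `2` because the error of approximate
invertibility of the first map is transported by the second. -/
lemma epsIsom_comp {ε δ : ℝ} (hZ : MetrizedBy dZ) (hε : 0 < ε) (hδ : 0 < δ)
    (hXY : (epsIsom ε X dX Y dY).Nonempty) (hYZ : (epsIsom δ Y dY Z dZ).Nonempty) :
    (epsIsom (2 * (ε + δ)) X dX Z dZ).Nonempty := by
  obtain ⟨f, hfc, hfa, hfi, g, hgc, hga, hfg⟩ := hXY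
  obtain ⟨f', hfc', hfa', hfi', g', hgc', hga', hfg'⟩ := hYZ
  refine ⟨f' ∘ f, hfc'.comp hfc, hfa'.comp hfa, fun x y => ?_, g ∘ g', hgc.comp hgc',
    hga.comp hga', fun z => ?_⟩
  · have h1 := abs_lt.1 (hfi x y)
    have h2 := abs_lt.1 (hfi' (f x) (f y))
    simp only [Function.comp_apply]
    exact abs_lt.2 ⟨by linarith, by linarith⟩
  · have h1 := hZ.triangle (f' (f (g (g' z)))) (f' (g' z)) z
    have h2 := (abs_lt.1 (hfi' (f (g (g' z))) (g' z))).2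
    have h3 := hfg (g' z)
    have h4 := hfg' z
    simp only [Function.comp_apply]
    linarith

lemma intertwiningGap_le {ε : ℝ} (hε : 0 < ε) (h₁ : (epsIsom ε X dX Y dY).Nonempty)
    (h₂ : (epsIsom ε Y dY X dX).Nonempty) : intertwiningGap X dX Y dY ≤ ENNReal.ofReal ε :=
  sInf_le ⟨ε, hε, h₁, h₂, rfl⟩

lemma nonempty_epsIsom_of_gap_lt {r : ℝ} (h : intertwiningGap X dX Y dY < ENNReal.ofReal r) :
    (epsIsom r X dX Y dY).Nonempty ∧ (epsIsom r Y dY X dX).Nonempty := by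
  obtain ⟨_, ⟨ε, hε, h₁, h₂, rfl⟩, hr⟩ := sInf_lt_iff.1 h
  have hεr : ε ≤ r := ((ENNReal.ofReal_lt_ofReal_iff_of_nonneg hε.le).1 hr).le
  exact ⟨h₁.mono (epsIsom_mono hεr), h₂.mono (epsIsom_mono hεr)⟩

lemma intertwiningGap_comm : intertwiningGap X dX Y dY = intertwiningGap Y dY X dX := by
  unfold intertwiningGap
  congr 1
  ext r
  exact exists_congr fun ε => and_congr_right fun _ => and_left_comm

/-- Constant maps are approximate isometries with error bounded by the diameters. -/
lemma intertwiningGap_ne_top (hX : IsCompactConvexMetric X dX) (hY : IsCompactConvexMetric Y dY) :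
    intertwiningGap X dX Y dY ≠ ∞ := by
  have := hX.compactSpace
  have := hY.compactSpace
  obtain ⟨D, hD, hDX⟩ := hX.metrizedBy.exists_bound
  obtain ⟨D', hD', hDY⟩ := hY.metrizedBy.exists_bound
  obtain ⟨x₀, hx₀⟩ := hX.nonempty
  obtain ⟨y₀, hy₀⟩ := hY.nonempty
  refine ((intertwiningGap_le (ε := D + D') (by linarith)
    ⟨fun _ => ⟨y₀, hy₀⟩, continuous_const, isAffine_const _, fun x y => ?_,
      fun _ => ⟨x₀, hx₀⟩, continuous_const, isAffine_const _, fun y => ?_⟩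
    ⟨fun _ => ⟨x₀, hx₀⟩, continuous_const, isAffine_const _, fun x y => ?_,
      fun _ => ⟨y₀, hy₀⟩, continuous_const, isAffine_const _, fun y => ?_⟩).trans_lt
    ENNReal.ofReal_lt_top).ne
  · rw [hY.metrizedBy.self, zero_sub, abs_neg, abs_of_nonneg (hX.metrizedBy.nonneg _ _)]
    linarith [hDX x y]
  · linarith [hDY ⟨y₀, hy₀⟩ y]
  · rw [hX.metrizedBy.self, zero_sub, abs_neg, abs_of_nonneg (hY.metrizedBy.nonneg _ _)]
    linarith [hDY x y]
  · linarith [hDX ⟨x₀, hx₀⟩ y]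

lemma intertwiningGap_triangle (hX : MetrizedBy dX) (hZ : MetrizedBy dZ) :
    intertwiningGap X dX Z dZ ≤ 2 * (intertwiningGap X dX Y dY + intertwiningGap Y dY Z dZ) := by
  rcases eq_or_ne (intertwiningGap X dX Y dY) ∞ with h | h₁
  · simp [h]
  rcases eq_or_ne (intertwiningGap Y dY Z dZ) ∞ with h | h₂
  · simp [h]
  lift intertwiningGap X dX Y dY to NNReal using h₁ with a ha
  lift intertwiningGap Y dY Z dZ to NNReal using h₂ with b hb
  refine ENNReal.le_of_forall_pos_le_add fun ε hε _ => ?_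
  have hlt : ∀ c : NNReal, (c : ℝ≥0∞) < ENNReal.ofReal (c + ε / 4) := fun c => by
    rw [← ENNReal.ofReal_coe_nnreal]
    exact ENNReal.ofReal_lt_ofReal_iff (by positivity) |>.2 (by simpa using hε)
  obtain ⟨h1, h2⟩ := nonempty_epsIsom_of_gap_lt (ha ▸ hlt a)
  obtain ⟨h3, h4⟩ := nonempty_epsIsom_of_gap_lt (hb ▸ hlt b)
  have ha0 : 0 < (a : ℝ) + ε / 4 := by positivity
  have hb0 : 0 < (b : ℝ) + ε / 4 := by positivity
  refine (intertwiningGap_le (ε := 2 * ((a + ε / 4) + (b + ε / 4))) (by positivity)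
    (epsIsom_comp hZ ha0 hb0 h1 h3) ?_).trans_eq ?_
  · rw [add_comm ((a : ℝ) + ε / 4)]
    exact epsIsom_comp hX hb0 ha0 h4 h2
  · have : 2 * (((a : ℝ) + ε / 4) + (b + ε / 4)) = ((2 * (a + b) + ε : NNReal) : ℝ) := by
      push_cast; ring
    rw [this, ENNReal.ofReal_coe_nnreal]
    push_cast
    rfl

lemma AffineIsometry.nonempty_epsIsom (φ : AffineIsometry X dX Y dY)
    (ψ : AffineIsometry Z dZ Z' dZ') (hX : IsCompactConvexMetric X dX) (hY : MetrizedBy dY)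
    (hZ : IsCompactConvexMetric Z dZ) (hZ' : MetrizedBy dZ') {ε : ℝ}
    (h : (epsIsom ε X dX Z dZ).Nonempty) :
    (epsIsom ε Y dY Z' dZ').Nonempty := by
  obtain ⟨f, hfc, hfa, hfi, g, hgc, hga, hfg⟩ := h
  refine ⟨fun y => ψ.toEquiv (f (φ.toEquiv.symm y)),
    (ψ.continuous hZ.metrizedBy hZ').comp
      (hfc.comp ((φ.symm hX.convex).continuous hY hX.metrizedBy)),
    ψ.affine.comp (hfa.comp (φ.symm hX.convex).affine), fun x y => ?_,
    fun z => φ.toEquiv (g (ψ.toEquiv.symm z)), (φ.continuous hX.metrizedBy hY).comp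
      (hgc.comp ((ψ.symm hZ.convex).continuous hZ' hZ.metrizedBy)),
    φ.affine.comp (hga.comp (ψ.symm hZ.convex).affine), fun z => ?_⟩
  · have := hfi (φ.toEquiv.symm x) (φ.toEquiv.symm y)
    rwa [← ψ.isometric, ← φ.isometric, Equiv.apply_symm_apply, Equiv.apply_symm_apply] at this
  · have := hfg (ψ.toEquiv.symm z)
    simp only [Equiv.symm_apply_apply]
    rwa [← ψ.isometric, Equiv.apply_symm_apply] at this

/-- The gap is invariant under affine isometric isomorphisms. -/
lemma intertwiningGap_congr (φ : AffineIsometry X dX Y dY) (ψ : AffineIsometry Z dZ Z' dZ')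
    (hX : IsCompactConvexMetric X dX) (hY : IsCompactConvexMetric Y dY)
    (hZ : IsCompactConvexMetric Z dZ) (hZ' : IsCompactConvexMetric Z' dZ') :
    intertwiningGap X dX Z dZ = intertwiningGap Y dY Z' dZ' := by
  have hφ := φ.symm hX.convex
  have hψ := ψ.symm hZ.convex
  unfold intertwiningGap
  congr 1
  ext r
  refine exists_congr fun ε => and_congr_right fun _ => ?_
  constructor
  · rintro ⟨h1, h2, h⟩
    exact ⟨φ.nonempty_epsIsom ψ hX hY.metrizedBy hZ hZ'.metrizedBy h1,
      ψ.nonempty_epsIsom φ hZ hZ'.metrizedBy hX hY.metrizedBy h2, h⟩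
  · rintro ⟨h1, h2, h⟩
    exact ⟨hφ.nonempty_epsIsom hψ hY hX.metrizedBy hZ' hZ.metrizedBy h1,
      hψ.nonempty_epsIsom hφ hZ' hZ.metrizedBy hY hX.metrizedBy h2, h⟩

lemma AffineIsometry.mem_epsIsom (φ : AffineIsometry X dX Y dY) (hX : IsCompactConvexMetric X dX)
    (hY : MetrizedBy dY) {ε : ℝ} (hε : 0 < ε) : ⇑φ.toEquiv ∈ epsIsom ε X dX Y dY := by
  refine ⟨φ.continuous hX.metrizedBy hY, φ.affine, fun x y => ?_, φ.toEquiv.symm,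
    (φ.symm hX.convex).continuous hY hX.metrizedBy, (φ.symm hX.convex).affine, fun y => ?_⟩
  · simpa [φ.isometric] using hε
  · simpa [hY.self] using hε

lemma intertwiningGap_eq_zero_of_affineIsometry (φ : AffineIsometry X dX Y dY)
    (hX : IsCompactConvexMetric X dX) (hY : IsCompactConvexMetric Y dY) :
    intertwiningGap X dX Y dY = 0 := by
  refine le_antisymm (ENNReal.le_of_forall_pos_le_add fun ε hε _ => ?_) zero_le
  rw [zero_add, ← ENNReal.ofReal_coe_nnreal]
  exact intertwiningGap_le (NNReal.coe_pos.2 hε) ⟨_, φ.mem_epsIsom hX hY.metrizedBy hε⟩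
    ⟨_, (φ.symm hX.convex).mem_epsIsom hY hX.metrizedBy hε⟩

/-- If the gap vanishes, then a pointwise limit of `1 / (n + 1)`-isometries along an ultrafilter is
an affine isometry; it is onto because the limits of the approximate preimages of a point are
preimages. -/
lemma nonempty_affineIsometry_of_gap_eq_zero [T2Space V₂] [ContinuousAdd V₂] [ContinuousSMul ℝ V₂]
    (hX : IsCompactConvexMetric X dX) (hY : IsCompactConvexMetric Y dY)
    (h : intertwiningGap X dX Y dY = 0) : Nonempty (AffineIsometry X dX Y dY) := by
  have := hX.compactSpace
  have := hY.compactSpace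
  have hlt : ∀ n : ℕ, (epsIsom (1 / ((n : ℝ) + 1)) X dX Y dY).Nonempty := fun n =>
    (nonempty_epsIsom_of_gap_lt (by rw [h]; simp; positivity)).1
  choose f hfc hfa hfi g hgc hga hfg using hlt
  let U : Ultrafilter ℕ := hyperfilter ℕ
  have hU : Tendsto (fun n : ℕ => 1 / ((n : ℝ) + 1)) U (𝓝 0) :=
    tendsto_one_div_add_atTop_nhds_zero_nat.mono_left Nat.hyperfilter_le_atTop
  have hF : ∀ x, ∃ y, Tendsto (fun n => f n x) U (𝓝 y) := fun x => by
    obtain ⟨y, -, hy⟩ := isCompact_univ.ultrafilter_le_nhds (U.map fun n => f n x) (by simp)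
    exact ⟨y, hy⟩
  choose F hF using hF
  have hlimX : ∀ {a b : ℕ → X} {x y : X}, Tendsto a U (𝓝 x) → Tendsto b U (𝓝 y) →
      Tendsto (fun n => dX (a n) (b n)) U (𝓝 (dX x y)) := fun ha hb =>
    (hX.metrizedBy.continuous_dist.tendsto _).comp (ha.prodMk_nhds hb)
  have hlimY : ∀ {a b : ℕ → Y} {x y : Y}, Tendsto a U (𝓝 x) → Tendsto b U (𝓝 y) →
      Tendsto (fun n => dY (a n) (b n)) U (𝓝 (dY x y)) := fun ha hb =>
    (hY.metrizedBy.continuous_dist.tendsto _).comp (ha.prodMk_nhds hb)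
  have hiso : ∀ x y, dY (F x) (F y) = dX x y := by
    intro x y
    have h1 : Tendsto (fun n => dY (f n x) (f n y) - dX x y) U (𝓝 0) :=
      squeeze_zero_norm (fun n => (hfi n x y).le) hU
    exact sub_eq_zero.1 (tendsto_nhds_unique ((hlimY (hF x) (hF y)).sub_const _) h1)
  have haff : IsAffine fun x => (F x : V₂) := by
    intro x y z s t hs ht hst hz
    have hval : ∀ x, Tendsto (fun n => (f n x : V₂)) U (𝓝 (F x)) := fun x =>
      (continuous_subtype_val.tendsto _).comp (hF x)
    refine tendsto_nhds_unique (hval z)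
      ((((hval x).const_smul s).add ((hval y).const_smul t)).congr fun n => ?_)
    exact (hfa n x y z s t hs ht hst hz).symm
  have hinj : Function.Injective F := fun x y hxy => by
    rw [← hX.eq_zero_iff, ← hiso, hxy, hY.metrizedBy.self]
  have hsurj : Function.Surjective F := by
    intro y
    obtain ⟨x, -, hx⟩ := isCompact_univ.ultrafilter_le_nhds (U.map fun n => g n y) (by simp)
    have hx : Tendsto (fun n => g n y) U (𝓝 x) := hx
    refine ⟨x, (hY.eq_zero_iff _ _).1 (le_antisymm ?_ (hY.metrizedBy.nonneg _ _))⟩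
    have h1 : Tendsto (fun n => dY (F x) (f n x) + (dX x (g n y) + 1 / ((n : ℝ) + 1)) +
        1 / ((n : ℝ) + 1)) U (𝓝 0) := by
      have := ((hlimY (tendsto_const_nhds (x := F x)) (hF x)).add
        ((hlimX (tendsto_const_nhds (x := x)) hx).add hU)).add hU
      simpa [hX.metrizedBy.self, hY.metrizedBy.self] using this
    refine ge_of_tendsto h1 (Eventually.of_forall fun n => ?_)
    have h2 := hY.triangle (F x) (f n x) y
    have h3 := hY.triangle (f n x) (f n (g n y)) y
    have h4 := (abs_lt.1 (hfi n x (g n y))).2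
    have h5 := hfg n y
    linarith
  exact ⟨⟨Equiv.ofBijective F ⟨hinj, hsurj⟩, haff, hiso⟩⟩

end Gap

/-- The gap descends to a quasimetric with constant `2` on isomorphism classes. -/
theorem MetricBauerSimplex.exists_isQuasimetric :
    ∃ d : MetricBauerSimplex.Class.{u} → MetricBauerSimplex.Class.{u} → ℝ,
      (∀ X Y : MetricBauerSimplex.{u}, ENNReal.ofReal (d X.toClass Y.toClass) = X.gap Y) ∧
        IsQuasimetric 2 d := by
  have hne : ∀ X Y : MetricBauerSimplex.{u}, X.gap Y ≠ ∞ := fun X Y =>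
    intertwiningGap_ne_top X.isMetricBauerSimplex.toIsCompactConvexMetric
      Y.isMetricBauerSimplex.toIsCompactConvexMetric
  refine ⟨Quotient.lift₂ (fun X Y => (X.gap Y).toReal) ?_, ?_, ?_⟩
  · rintro X Y X' Y' ⟨φ⟩ ⟨ψ⟩
    exact congrArg ENNReal.toReal (intertwiningGap_congr φ ψ
      X.isMetricBauerSimplex.toIsCompactConvexMetric
      X'.isMetricBauerSimplex.toIsCompactConvexMetric
      Y.isMetricBauerSimplex.toIsCompactConvexMetric
      Y'.isMetricBauerSimplex.toIsCompactConvexMetric)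
  · exact fun X Y => ENNReal.ofReal_toReal (hne X Y)
  · constructor
    · rintro ⟨X⟩ ⟨Y⟩
      exact ENNReal.toReal_nonneg
    · rintro ⟨X⟩ ⟨Y⟩
      change (X.gap Y).toReal = 0 ↔ Quotient.mk setoid X = Quotient.mk setoid Y
      rw [ENNReal.toReal_eq_zero_iff, or_iff_left (hne X Y), Quotient.eq]
      exact ⟨nonempty_affineIsometry_of_gap_eq_zero
          X.isMetricBauerSimplex.toIsCompactConvexMetric
          Y.isMetricBauerSimplex.toIsCompactConvexMetric,
        fun ⟨φ⟩ => intertwiningGap_eq_zero_of_affineIsometry φ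
          X.isMetricBauerSimplex.toIsCompactConvexMetric
          Y.isMetricBauerSimplex.toIsCompactConvexMetric⟩
    · rintro ⟨X⟩ ⟨Y⟩
      exact congrArg ENNReal.toReal intertwiningGap_comm
    · rintro ⟨X⟩ ⟨Y⟩ ⟨Z⟩
      change (X.gap Z).toReal ≤ 2 * ((X.gap Y).toReal + (Y.gap Z).toReal)
      rw [← ENNReal.toReal_add (hne X Y) (hne Y Z), ← ENNReal.toReal_ofNat, ← ENNReal.toReal_mul]
      refine ENNReal.toReal_mono
        (ENNReal.mul_ne_top (by simp) (ENNReal.add_ne_top.2 ⟨hne X Y, hne Y Z⟩)) ?_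
      exact intertwiningGap_triangle X.isMetricBauerSimplex.metrizedBy
        Z.isMetricBauerSimplex.metrizedBy

/-! ### The intertwining gap is at most twice the quantum Gromov--Hausdorff distance -/

section Selection

universe u₁ u₂

variable {V₁ : Type u₁} [AddCommGroup V₁] [Module ℝ V₁] [TopologicalSpace V₁]
  {X : Set V₁} {dX : X → X → ℝ}
  {V₂ : Type u₂} [AddCommGroup V₂] [Module ℝ V₂] [TopologicalSpace V₂]
  {Y : Set V₂} {dY : Y → Y → ℝ}

/-- Barycentres of probability measures on a compact convex set. -/
lemma exists_barycenter (hc : IsCompact Y) (hconv : Convex ℝ Y) {P : Type*} [TopologicalSpace P]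
    [CompactSpace P] [MeasurableSpace P] [BorelSpace P] (μ : ProbabilityMeasure P) {f : P → Y}
    (hf : Continuous f) : ∃ y, ∀ k : Aff Y, k.1 y = ∫ p, k.1 (f p) ∂(μ : Measure P) := by
  have hint : ∀ k : Aff Y, Integrable (fun p => k.1 (f p)) (μ : Measure P) := fun k =>
    (k.1.continuous.comp hf).integrable_of_hasCompactSupport (HasCompactSupport.of_compactSpace _)
  let φ : StateSpace (Aff.unit Y) :=
    ⟨{ toFun := fun k => ∫ p, k.1 (f p) ∂(μ : Measure P)
       map_add' := fun k l => integral_add (hint k) (hint l)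
       map_smul' := fun c k => integral_const_mul c _ },
      fun k hk => integral_nonneg fun p => hk (f p), by
        change ∫ _, (1 : ℝ) ∂(μ : Measure P) = 1
        simp⟩
  obtain ⟨y, hy⟩ := exists_eq_evalState hc hconv φ
  exact ⟨y, fun k => congrArg (fun σ : StateSpace (Aff.unit Y) => σ.1 k) hy.symm⟩

/-- A continuous map on the extremal boundary of a metric Bauer simplex extends to a continuous
affine map, by taking barycentres of the images of representing measures. -/
lemma IsMetricBauerSimplex.exists_affine_extension (hX : IsMetricBauerSimplex X dX)
    (hY : IsMetricBauerSimplex Y dY) {f : Boundary X → Y} (hf : Continuous f) :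
    ∃ F : X → Y, Continuous F ∧ IsAffine (fun x => (F x : V₂)) ∧ ∀ (k : Aff Y) x,
      k.1 (F x) = ∫ e, k.1 (f e) ∂(hX.reprMeasure x : Measure (Boundary X)) := by
  have := hX.compactSpace_boundary
  choose F hF using fun x =>
    exists_barycenter hY.isCompact hY.convex (hX.reprMeasure x) hf
  have hext : ∀ k : Aff Y, (fun x => k.1 (F x)) =
      (hX.affExtend ⟨fun e => k.1 (f e), k.1.continuous.comp hf⟩).1 := fun k =>
    funext fun x => hF x k
  refine ⟨F, hY.continuous_of_forall_aff fun k => ?_, hY.isAffine_of_forall_aff fun k => ?_,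
    fun k x => hF x k⟩
  · rw [hext]
    exact ContinuousMap.continuous _
  · rw [hext]
    exact (hX.affExtend _).2

/-- Let `B` be a set of pairs of affine functions, regarded as a distance between points of `X` and
of `Y`. If every point of `X` is at distance less than `r` from some point of `Y`, then the nearby
points can be chosen continuously on the boundary, by a partition of unity, hence continuously and
affinely on `X`. -/
lemma IsMetricBauerSimplex.exists_affine_selection [ContinuousAdd V₂] [ContinuousSMul ℝ V₂]
    (hX : IsMetricBauerSimplex X dX) (hY : IsMetricBauerSimplex Y dY) {B : Set (Aff X × Aff Y)}
    (hB : ∀ p ∈ B, ∀ x x', |p.1.1 x - p.1.1 x'| ≤ dX x x') {r : ℝ}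
    (hr : ∀ x, ∃ y, ∃ r' < r, ∀ p ∈ B, |p.1.1 x - p.2.1 y| ≤ r') :
    ∃ F : X → Y, Continuous F ∧ IsAffine (fun x => (F x : V₂)) ∧
      ∀ x, ∀ p ∈ B, |p.1.1 x - p.2.1 (F x)| ≤ r := by
  have := hX.compactSpace_boundary
  have := hX.metrizedBy_boundary.t2Space
  let t : Boundary X → Set V₂ := fun e =>
    {v | ∃ hv : v ∈ Y, ∃ r' < r, ∀ p ∈ B, |p.1.1 e.incl - p.2.1 ⟨v, hv⟩| ≤ r'}
  have ht : ∀ e, Convex ℝ (t e) := by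
    rintro e v ⟨hv, r₁, hr₁, h₁⟩ w ⟨hw, r₂, hr₂, h₂⟩ a b ha hb hab
    refine ⟨hY.convex hv hw ha hb hab, max r₁ r₂, max_lt hr₁ hr₂, fun p hp => ?_⟩
    rw [Aff.map_mem p.2 (x := ⟨v, hv⟩) (y := ⟨w, hw⟩) ha hb hab rfl]
    have e1 : p.1.1 e.incl - (a * p.2.1 ⟨v, hv⟩ + b * p.2.1 ⟨w, hw⟩) =
        a * (p.1.1 e.incl - p.2.1 ⟨v, hv⟩) + b * (p.1.1 e.incl - p.2.1 ⟨w, hw⟩) := by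
      linear_combination (-(p.1.1 e.incl)) * hab
    rw [e1]
    refine (abs_add_le _ _).trans ?_
    rw [abs_mul, abs_mul, abs_of_nonneg ha, abs_of_nonneg hb]
    have h3 := mul_le_mul_of_nonneg_left ((h₁ p hp).trans (le_max_left r₁ r₂)) ha
    have h4 := mul_le_mul_of_nonneg_left ((h₂ p hp).trans (le_max_right r₁ r₂)) hb
    calc _ ≤ a * max r₁ r₂ + b * max r₁ r₂ := add_le_add h3 h4
      _ = max r₁ r₂ := by rw [← add_mul, hab, one_mul]
  have hloc : ∀ e, ∃ v, ∀ᶠ e' in 𝓝 e, v ∈ t e' := by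
    intro e
    obtain ⟨y, r', hr', h⟩ := hr e.incl
    refine ⟨y, (hX.metrizedBy_boundary.mem_nhds_iff _ _).2 ⟨(r - r') / 2, by linarith, ?_⟩⟩
    intro e' he'
    refine ⟨y.2, (r + r') / 2, by linarith, fun p hp => ?_⟩
    have h1 := h p hp
    have h2 := hB p hp e'.incl e.incl
    have h3 : dX e.incl e'.incl < (r - r') / 2 := he'
    rw [hX.symm] at h2
    have h4 := abs_sub_le (p.1.1 e'.incl) (p.1.1 e.incl) (p.2.1 y)
    simp only [Subtype.coe_eta]
    linarith
  obtain ⟨g, hg⟩ := exists_continuous_forall_mem_convex_of_local_const ht hloc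
  choose hgY hg using hg
  have hgc : Continuous fun e => (⟨g e, hgY e⟩ : Y) := g.continuous.subtype_mk _
  obtain ⟨F, hFc, hFa, hF⟩ := hX.exists_affine_extension hY hgc
  refine ⟨F, hFc, hFa, fun x p hp => ?_⟩
  rw [hF, hX.represents_reprMeasure x p.1]
  refine hX.norm_integral_sub_integral_le (Aff.restrict p.1).continuous
    (p.2.1.continuous.comp hgc) (fun e => ?_) _
  obtain ⟨r', hr', h⟩ := hg e
  exact (h p hp).trans hr'.le

/-- If the distance of `exists_affine_selection` restricts to the given metrics on `X` and on `Y`,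
the maps selected in both directions move points by at most `r`, so that the map from `X` to `Y`
is an `ε`-isometry for every `ε > 2 * r`. -/
lemma IsMetricBauerSimplex.nonempty_epsIsom [ContinuousAdd V₁] [ContinuousSMul ℝ V₁]
    [ContinuousAdd V₂] [ContinuousSMul ℝ V₂]
    (hX : IsMetricBauerSimplex X dX) (hY : IsMetricBauerSimplex Y dY) {B : Set (Aff X × Aff Y)}
    (hB₁ : ∀ x x' C, dX x x' ≤ C ↔ ∀ p ∈ B, |p.1.1 x - p.1.1 x'| ≤ C)
    (hB₂ : ∀ y y' C, dY y y' ≤ C ↔ ∀ p ∈ B, |p.2.1 y - p.2.1 y'| ≤ C) {r ε : ℝ} (hrε : 2 * r < ε)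
    (hr₁ : ∀ x, ∃ y, ∃ r' < r, ∀ p ∈ B, |p.1.1 x - p.2.1 y| ≤ r')
    (hr₂ : ∀ y, ∃ x, ∃ r' < r, ∀ p ∈ B, |p.1.1 x - p.2.1 y| ≤ r') :
    (epsIsom ε X dX Y dY).Nonempty := by
  obtain ⟨F, hFc, hFa, hF⟩ := hX.exists_affine_selection hY
    (fun p hp x x' => (hB₁ x x' _).1 le_rfl p hp) hr₁
  obtain ⟨G, hGc, hGa, hG⟩ := hY.exists_affine_selection hX (B := Prod.swap ⁻¹' B)
    (fun p hp y y' => (hB₂ y y' _).1 le_rfl p.swap hp) (r := r) (fun y => by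
      obtain ⟨x, r', hr', h⟩ := hr₂ y
      exact ⟨x, r', hr', fun p hp => by rw [abs_sub_comm]; exact h p.swap hp⟩)
  have hG' : ∀ y, ∀ p ∈ B, |p.2.1 y - p.1.1 (G y)| ≤ r := fun y p hp => hG y p.swap (by simpa)
  refine ⟨F, hFc, hFa, fun x x' => lt_of_le_of_lt ?_ hrε, G, hGc, hGa,
    fun y => lt_of_le_of_lt ?_ hrε⟩
  · have h1 : dY (F x) (F x') ≤ dX x x' + 2 * r := (hB₂ _ _ _).2 fun p hp => by
      have h1 := abs_le.1 ((hB₁ x x' _).1 le_rfl p hp)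
      have h2 := abs_le.1 (hF x p hp)
      have h3 := abs_le.1 (hF x' p hp)
      exact abs_le.2 ⟨by linarith, by linarith⟩
    have h2 : dX x x' ≤ dY (F x) (F x') + 2 * r := (hB₁ _ _ _).2 fun p hp => by
      have h1 := abs_le.1 ((hB₂ (F x) (F x') _).1 le_rfl p hp)
      have h2 := abs_le.1 (hF x p hp)
      have h3 := abs_le.1 (hF x' p hp)
      exact abs_le.2 ⟨by linarith, by linarith⟩
    exact abs_le.2 ⟨by linarith, by linarith⟩
  · refine (hB₂ _ _ _).2 fun p hp => ?_
    have h1 := abs_le.1 (hF (G y) p hp)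
    have h2 := abs_le.1 (hG' y p hp)
    exact abs_le.2 ⟨by linarith, by linarith⟩

/-- If the Lipschitz seminorm is the quotient of `L` under `π`, then the metric is computed by the
unit ball of `L`. -/
lemma IsMetricBauerSimplex.dist_le_iff_of_quotient (hX : IsMetricBauerSimplex X dX) {G : Type*}
    [AddCommGroup G] [Module ℝ G] {L : G → ℝ≥0∞} (hL : IsExtSeminorm ℝ L) (π : G →ₗ[ℝ] Aff X)
    (hle : ∀ g, affSeminorm dX (π g) ≤ L g)
    (hex : ∀ h t, affSeminorm dX h < t → ∃ g, π g = h ∧ L g < t) (x x' : X) (C : ℝ) :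
    dX x x' ≤ C ↔ ∀ g, L g ≤ 1 → |(π g).1 x - (π g).1 x'| ≤ C := by
  constructor
  · exact fun h g hg => (hX.metrizedBy.lipSeminorm_le_one_iff.1 ((hle g).trans hg) x x').trans h
  · intro H
    refine hX.dist_le_of_forall fun h hh => ?_
    -- The infimum defining the quotient need not be attained, hence the scaling by `t > 1`.
    have hscale : ∀ t : ℝ, 1 < t → |h.1 x - h.1 x'| ≤ t * C := by
      intro t ht
      have ht0 : 0 < t := one_pos.trans ht
      obtain ⟨g, rfl, hgt⟩ := hex h (ENNReal.ofReal t)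
        ((hX.metrizedBy.lipSeminorm_le_one_iff.2 hh).trans_lt (by simpa using ht))
      have h1 : L (t⁻¹ • g) ≤ 1 := by
        rw [hL.smul, Real.enorm_eq_ofReal (inv_nonneg.2 ht0.le)]
        calc _ ≤ ENNReal.ofReal t⁻¹ * ENNReal.ofReal t := by gcongr
          _ = 1 := by rw [← ENNReal.ofReal_mul (inv_nonneg.2 ht0.le), inv_mul_cancel₀ ht0.ne',
            ENNReal.ofReal_one]
      have h2 := H _ h1
      rw [map_smul] at h2
      have h3 : |t⁻¹ * (π g).1 x - t⁻¹ * (π g).1 x'| ≤ C := h2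
      rwa [← mul_sub, abs_mul, abs_of_pos (inv_pos.2 ht0), inv_mul_le_iff₀ ht0] at h3
    have hlim : Tendsto (fun t : ℝ => t * C) (𝓝[>] 1) (𝓝 (1 * C)) :=
      (tendsto_id.mono_left nhdsWithin_le_nhds).mul_const C
    rw [one_mul] at hlim
    exact ge_of_tendsto hlim (eventually_mem_nhdsWithin.mono hscale)

/-- The Hausdorff distance for an admissible Lip-norm controls the gap. -/
lemma IsMetricBauerSimplex.intertwiningGap_le_stateHausdorff [ContinuousAdd V₁]
    [ContinuousSMul ℝ V₁] [ContinuousAdd V₂] [ContinuousSMul ℝ V₂]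
    (hX : IsMetricBauerSimplex X dX) (hY : IsMetricBauerSimplex Y dY)
    {L : Aff X × Aff Y → ℝ≥0∞}
    (hL : IsAdmissible (Aff.unit X) (affSeminorm dX) (Aff.unit Y) (affSeminorm dY) L) :
    intertwiningGap X dX Y dY ≤ 2 * stateHausdorff (Aff.unit X) (Aff.unit Y) L := by
  rcases eq_or_ne (stateHausdorff (Aff.unit X) (Aff.unit Y) L) ∞ with h | h
  · simp [h]
  lift stateHausdorff (Aff.unit X) (Aff.unit Y) L to NNReal using h with a ha
  refine ENNReal.le_of_forall_pos_le_add fun ε hε _ => ?_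
  obtain ⟨r₀, ⟨-, hr₁, hr₂⟩, hr₀⟩ := sInf_lt_iff.1
    (show stateHausdorff (Aff.unit X) (Aff.unit Y) L < ((a + ε / 4 : NNReal) : ℝ≥0∞) by
      rw [← ha]; exact_mod_cast lt_add_of_pos_right a (by positivity))
  have hclose : ∀ x y, stateDist (Aff.unit X, Aff.unit Y) L
      (StateSpace.inl (Aff.unit X) (Aff.unit Y) (evalState x))
      (StateSpace.inr (Aff.unit X) (Aff.unit Y) (evalState y)) < r₀ →
      ∃ r' < ((a + ε / 4 : NNReal) : ℝ), ∀ p ∈ {p : Aff X × Aff Y | L p ≤ 1},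
        |p.1.1 x - p.2.1 y| ≤ r' := by
    intro x y hxy
    have hfin := (hxy.trans hr₀).trans ENNReal.coe_lt_top
    refine ⟨_, (ENNReal.toReal_lt_toReal hfin.ne ENNReal.coe_ne_top).2 (hxy.trans hr₀),
      fun p hp => ?_⟩
    exact abs_sub_le_of_stateDist_le
      (σ := StateSpace.inl (Aff.unit X) (Aff.unit Y) (evalState x))
      (τ := StateSpace.inr (Aff.unit X) (Aff.unit Y) (evalState y))
      ENNReal.toReal_nonneg (ENNReal.ofReal_toReal hfin.ne).ge hp
  have hB₁ : ∀ x x' C, dX x x' ≤ C ↔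
      ∀ p ∈ {p : Aff X × Aff Y | L p ≤ 1}, |p.1.1 x - p.1.1 x'| ≤ C :=
    hX.dist_le_iff_of_quotient hL.isLipNorm.isExtSeminorm (LinearMap.fst ℝ _ _)
      (fun g => (hL.quotient_left _).trans_le (iInf_le _ g.2)) fun h t ht => by
        rw [hL.quotient_left, iInf_lt_iff] at ht
        obtain ⟨k, hk⟩ := ht
        exact ⟨(h, k), rfl, hk⟩
  have hB₂ : ∀ y y' C, dY y y' ≤ C ↔
      ∀ p ∈ {p : Aff X × Aff Y | L p ≤ 1}, |p.2.1 y - p.2.1 y'| ≤ C :=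
    hY.dist_le_iff_of_quotient hL.isLipNorm.isExtSeminorm (LinearMap.snd ℝ _ _)
      (fun g => (hL.quotient_right _).trans_le (iInf_le _ g.1)) fun k t ht => by
        rw [hL.quotient_right, iInf_lt_iff] at ht
        obtain ⟨h, hh⟩ := ht
        exact ⟨(h, k), rfl, hh⟩
  have hsel₁ : ∀ x, ∃ y, ∃ r' < ((a + ε / 4 : NNReal) : ℝ),
      ∀ p ∈ {p : Aff X × Aff Y | L p ≤ 1}, |p.1.1 x - p.2.1 y| ≤ r' := by
    intro x
    obtain ⟨τ, hτ⟩ := hr₁ (evalState x)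
    obtain ⟨y, rfl⟩ := exists_eq_evalState hY.isCompact hY.convex τ
    exact ⟨y, hclose x y hτ⟩
  have hsel₂ : ∀ y, ∃ x, ∃ r' < ((a + ε / 4 : NNReal) : ℝ),
      ∀ p ∈ {p : Aff X × Aff Y | L p ≤ 1}, |p.1.1 x - p.2.1 y| ≤ r' := by
    intro y
    obtain ⟨σ, hσ⟩ := hr₂ (evalState y)
    obtain ⟨x, rfl⟩ := exists_eq_evalState hX.isCompact hX.convex σ
    exact ⟨x, hclose x y hσ⟩
  have hlt : 2 * ((a + ε / 4 : NNReal) : ℝ) < ((2 * a + ε : NNReal) : ℝ) := by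
    have : (0 : ℝ) < ε := hε
    push_cast
    linarith
  refine (intertwiningGap_le (ε := ((2 * a + ε : NNReal) : ℝ)) (by positivity)
    (hX.nonempty_epsIsom hY hB₁ hB₂ hlt hsel₁ hsel₂)
    (hY.nonempty_epsIsom hX (B := Prod.swap ⁻¹' {p : Aff X × Aff Y | L p ≤ 1})
      (fun y y' C => (hB₂ y y' C).trans (Prod.swap_surjective.forall.trans Iff.rfl))
      (fun x x' C => (hB₁ x x' C).trans (Prod.swap_surjective.forall.trans Iff.rfl)) hlt
      (fun y => ?_) (fun x => ?_))).trans_eq ?_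
  · obtain ⟨x, r', hr', h⟩ := hsel₂ y
    exact ⟨x, r', hr', fun p hp => by rw [abs_sub_comm]; exact h p.swap hp⟩
  · obtain ⟨y, r', hr', h⟩ := hsel₁ x
    exact ⟨y, r', hr', fun p hp => by rw [abs_sub_comm]; exact h p.swap hp⟩
  · rw [ENNReal.ofReal_coe_nnreal]
    push_cast
    rfl

end Selection

lemma MetricBauerSimplex.gap_le_qdist (X Y : MetricBauerSimplex.{u}) :
    X.gap Y ≤ 2 * X.qdist Y := by
  simp only [qdist, quantumDist, ENNReal.mul_iInf_of_ne (two_ne_zero) (ENNReal.ofNat_ne_top)]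
  exact le_iInf₂ fun L hL =>
    X.isMetricBauerSimplex.intertwiningGap_le_stateHausdorff Y.isMetricBauerSimplex hL

/-! ### The quantum Gromov--Hausdorff distance is controlled by the intertwining gap -/

section Bridge

universe u₁ u₂

variable {V₁ : Type u₁} [AddCommGroup V₁] [Module ℝ V₁] [TopologicalSpace V₁]
  {X : Set V₁} {dX : X → X → ℝ}
  {V₂ : Type u₂} [AddCommGroup V₂] [Module ℝ V₂] [TopologicalSpace V₂]
  {Y : Set V₂} {dY : Y → Y → ℝ}

/-- Composition of a continuous affine function with a continuous affine map. -/
def Aff.comp (k : Aff Y) {f : X → Y} (hf : Continuous f) (hfa : IsAffine fun x => (f x : V₂)) :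
    Aff X :=
  ⟨⟨fun x => k.1 (f x), k.1.continuous.comp hf⟩, fun x y z s t hs ht hst hz =>
    k.2 _ _ _ s t hs ht hst (hfa x y z s t hs ht hst hz)⟩

/-- An affine function that is `t`-Lipschitz up to an additive error `δ` is within `δ` of a
`t`-Lipschitz one: it suffices to correct it on the extremal boundary. -/
lemma IsMetricBauerSimplex.exists_lipschitz_aff_near (hX : IsMetricBauerSimplex X dX) (u : Aff X)
    {t δ : ℝ} (ht : 0 ≤ t) (hu : ∀ x y, u.1 x - u.1 y ≤ t * dX x y + δ) :
    ∃ h : Aff X, affSeminorm dX h ≤ ENNReal.ofReal t ∧ ∀ x, |h.1 x - u.1 x| ≤ δ := by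
  obtain ⟨v, hv, hvu⟩ := hX.metrizedBy_boundary.exists_lipschitz_of_le_add
    (u := fun e => u.1 e.incl) ht fun e e' => hu e.incl e'.incl
  obtain ⟨h, hh, heq⟩ := hX.exists_aff_of_lipschitz ht hv
  refine ⟨h, (hX.metrizedBy.lipSeminorm_le_iff ht).2 hh, fun x => ?_⟩
  rw [heq, hX.represents_reprMeasure x u]
  exact hX.norm_integral_sub_integral_le (hX.metrizedBy_boundary.continuous_of_le hv)
    (Aff.restrict u).continuous hvu _

lemma exists_eq_smul_eval (hne : X.Nonempty) (hc : IsCompact X) (hconv : Convex ℝ X)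
    {ψ : Aff X →ₗ[ℝ] ℝ} (hψ : ∀ h, 0 ≤ h → 0 ≤ ψ h) :
    ∃ x : X, ∀ h : Aff X, ψ h = ψ (Aff.unit X) * h.1 x := by
  have : CompactSpace X := isCompact_iff_compactSpace.1 hc
  have hle : ∀ h : Aff X, ∃ r : ℝ, ψ h ≤ r * ψ (Aff.unit X) := by
    intro h
    obtain ⟨r, hr⟩ := Aff.exists_smul_unit_le h
    have h1 := hψ (r • Aff.unit X - h) fun x => sub_nonneg.2 (hr x)
    rw [map_sub, map_smul, smul_eq_mul] at h1
    exact ⟨r, by linarith⟩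
  have h0 : 0 ≤ ψ (Aff.unit X) := hψ _ fun x => zero_le_one (α := ℝ)
  rcases h0.eq_or_lt with h0 | h0
  · refine ⟨⟨_, hne.some_mem⟩, fun h => ?_⟩
    obtain ⟨r, hr⟩ := hle h
    obtain ⟨r', hr'⟩ := hle (-h)
    rw [← h0, mul_zero] at hr hr'
    rw [map_neg] at hr'
    rw [← h0, zero_mul]
    linarith
  · obtain ⟨x, hx⟩ := exists_eq_evalState hc hconv ⟨(ψ (Aff.unit X))⁻¹ • ψ,
      fun h hh => mul_nonneg (inv_nonneg.2 h0.le) (hψ h hh), inv_mul_cancel₀ h0.ne'⟩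
    refine ⟨x, fun h => ?_⟩
    have h1 : (ψ (Aff.unit X))⁻¹ * ψ h = h.1 x :=
      congrArg (fun σ : StateSpace (Aff.unit X) => σ.1 h) hx
    rw [← h1, mul_inv_cancel_left₀ h0.ne']

/-- The convex combination `t ev_x + (1 - t) ev_y`, as a state of `Aff(X) ⊕ Aff(Y)`. -/
def comboState (p : unitInterval × X × Y) : StateSpace (Aff.unit X, Aff.unit Y) :=
  ⟨{ toFun := fun q => (p.1 : ℝ) * q.1.1 p.2.1 + (1 - p.1) * q.2.1 p.2.2
     map_add' := fun q q' => by
      simp only [Prod.fst_add, Prod.snd_add, Submodule.coe_add, ContinuousMap.add_apply]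
      ring
     map_smul' := fun c q => by
      simp only [Prod.smul_fst, Prod.smul_snd, Submodule.coe_smul, ContinuousMap.smul_apply,
        smul_eq_mul, RingHom.id_apply]
      ring },
    fun q hq => add_nonneg (mul_nonneg p.1.2.1 (hq.1 _))
      (mul_nonneg (sub_nonneg.2 p.1.2.2) (hq.2 _)), by
      simp [Aff.unit]⟩

lemma comboState_apply (p : unitInterval × X × Y) (q : Aff X × Aff Y) :
    (comboState p).1 q = (p.1 : ℝ) * q.1.1 p.2.1 + (1 - p.1) * q.2.1 p.2.2 := rfl

lemma continuous_comboState : Continuous (comboState (X := X) (Y := Y)) := by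
  refine StateSpace.continuous_iff.2 fun q => ?_
  simp only [comboState_apply]
  have h1 := q.1.1.continuous
  have h2 := q.2.1.continuous
  fun_prop

lemma surjective_comboState (hX : IsCompactConvexMetric X dX) (hY : IsCompactConvexMetric Y dY) :
    Function.Surjective (comboState (X := X) (Y := Y)) := by
  intro φ
  obtain ⟨x, hx⟩ := exists_eq_smul_eval hX.nonempty hX.isCompact hX.convex
    (ψ := φ.1.comp (LinearMap.inl ℝ (Aff X) (Aff Y))) fun h hh => φ.2.1 _ ⟨hh, le_rfl⟩
  obtain ⟨y, hy⟩ := exists_eq_smul_eval hY.nonempty hY.isCompact hY.convex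
    (ψ := φ.1.comp (LinearMap.inr ℝ (Aff X) (Aff Y))) fun k hk => φ.2.1 _ ⟨le_rfl, hk⟩
  simp only [LinearMap.comp_apply, LinearMap.inl_apply, LinearMap.inr_apply] at hx hy
  have h1 : 0 ≤ φ.1 (Aff.unit X, 0) := φ.2.1 _ ⟨fun x => zero_le_one (α := ℝ), le_rfl⟩
  have h2 : 0 ≤ φ.1 (0, Aff.unit Y) := φ.2.1 _ ⟨le_rfl, fun x => zero_le_one (α := ℝ)⟩
  have h3 : φ.1 (Aff.unit X, 0) + φ.1 (0, Aff.unit Y) = 1 := by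
    rw [← map_add]
    exact (congrArg φ.1 (by simp)).trans φ.2.2
  refine ⟨(⟨φ.1 (Aff.unit X, 0), h1, by linarith⟩, x, y), Subtype.ext (LinearMap.ext fun q => ?_)⟩
  have h4 : φ.1 q = φ.1 (q.1, 0) + φ.1 (0, q.2) := by
    rw [← map_add]
    simp
  have h5 : 1 - φ.1 (Aff.unit X, 0) = φ.1 (0, Aff.unit Y) := by linarith
  calc (comboState (⟨φ.1 (Aff.unit X, 0), h1, by linarith⟩, x, y)).1 q
      = φ.1 (Aff.unit X, 0) * q.1.1 x + (1 - φ.1 (Aff.unit X, 0)) * q.2.1 y := rfl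
    _ = φ.1 (q.1, 0) + φ.1 (0, q.2) :=
      congrArg₂ _ (hx q.1).symm ((congrArg (· * q.2.1 y) h5).trans (hy q.2).symm)
    _ = φ.1 q := h4.symm

/-- The uniform distance between `h` and `k ∘ f`, divided by `c`. -/
def bridge (f : X → Y) (c : ℝ) (p : Aff X × Aff Y) : ℝ≥0∞ :=
  ⨆ x, ENNReal.ofReal (|p.1.1 x - p.2.1 (f x)| / c)

/-- The seminorm on `Aff(X) ⊕ Aff(Y)` built from the two Lipschitz seminorms and a bridge. -/
def bridgeSeminorm (dX : X → X → ℝ) (dY : Y → Y → ℝ) (f : X → Y) (c : ℝ) (p : Aff X × Aff Y) :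
    ℝ≥0∞ :=
  max (max (affSeminorm dX p.1) (affSeminorm dY p.2)) (bridge f c p)

variable {f : X → Y} {c : ℝ}

lemma bridge_le_iff (hc : 0 < c) {t : ℝ} (ht : 0 ≤ t) {p : Aff X × Aff Y} :
    bridge f c p ≤ ENNReal.ofReal t ↔ ∀ x, |p.1.1 x - p.2.1 (f x)| ≤ t * c := by
  simp only [bridge, iSup_le_iff, ENNReal.ofReal_le_ofReal_iff ht, div_le_iff₀ hc]

lemma bridgeSeminorm_le_iff {t : ℝ≥0∞} {p : Aff X × Aff Y} :
    bridgeSeminorm dX dY f c p ≤ t ↔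
      affSeminorm dX p.1 ≤ t ∧ affSeminorm dY p.2 ≤ t ∧ bridge f c p ≤ t := by
  simp only [bridgeSeminorm, max_le_iff, and_assoc]

lemma affSeminorm_left_le_bridgeSeminorm (a : Aff X) (k : Aff Y) :
    affSeminorm dX a ≤ bridgeSeminorm dX dY f c (a, k) :=
  (le_max_left (affSeminorm dX a) (affSeminorm dY k)).trans (le_max_left _ (bridge f c (a, k)))

lemma affSeminorm_right_le_bridgeSeminorm (a : Aff X) (k : Aff Y) :
    affSeminorm dY k ≤ bridgeSeminorm dX dY f c (a, k) :=
  (le_max_right (affSeminorm dX a) (affSeminorm dY k)).trans (le_max_left _ (bridge f c (a, k)))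

lemma bridgeSeminorm_mk_le {t : ℝ≥0∞} {a : Aff X} {k : Aff Y} (ha : affSeminorm dX a ≤ t)
    (hk : affSeminorm dY k ≤ t) (hb : bridge f c (a, k) ≤ t) :
    bridgeSeminorm dX dY f c (a, k) ≤ t :=
  max_le (max_le ha hk) hb

lemma isExtSeminorm_bridgeSeminorm (hX : MetrizedBy dX) (hY : MetrizedBy dY) (hc : 0 < c) :
    IsExtSeminorm ℝ (bridgeSeminorm dX dY f c) where
  add_le p q := by
    refine bridgeSeminorm_le_iff.2 ⟨?_, ?_, ?_⟩
    · refine (hX.isExtSeminorm_affSeminorm.add_le _ _).trans (add_le_add ?_ ?_) <;>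
        exact (le_max_left _ _).trans (le_max_left _ _)
    · refine (hY.isExtSeminorm_affSeminorm.add_le _ _).trans (add_le_add ?_ ?_) <;>
        exact (le_max_right _ _).trans (le_max_left _ _)
    · refine le_trans ?_ (add_le_add (le_max_right _ _) (le_max_right _ _))
      refine iSup_le fun x => le_trans ?_ (add_le_add (le_iSup _ x) (le_iSup _ x))
      rw [← ENNReal.ofReal_add (by positivity) (by positivity), ← add_div]
      refine ENNReal.ofReal_le_ofReal (div_le_div_of_nonneg_right ?_ hc.le)
      have : (p + q).1.1 x - (p + q).2.1 (f x) =
          (p.1.1 x - p.2.1 (f x)) + (q.1.1 x - q.2.1 (f x)) := by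
        simp only [Prod.fst_add, Prod.snd_add, Submodule.coe_add, ContinuousMap.add_apply]
        ring
      rw [this]
      exact abs_add_le _ _
  smul r p := by
    have hb : bridge f c (r • p) = ‖r‖ₑ * bridge f c p := by
      simp only [bridge, ENNReal.mul_iSup]
      refine iSup_congr fun x => ?_
      have : (r • p).1.1 x - (r • p).2.1 (f x) = r * (p.1.1 x - p.2.1 (f x)) := by
        simp only [Prod.smul_fst, Prod.smul_snd, Submodule.coe_smul, ContinuousMap.smul_apply,
          smul_eq_mul]
        ring
      rw [this, abs_mul, mul_div_assoc, ENNReal.ofReal_mul (abs_nonneg _),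
        Real.enorm_eq_ofReal_abs]
    have hmax : ∀ a b : ℝ≥0∞, ‖r‖ₑ * max a b = max (‖r‖ₑ * a) (‖r‖ₑ * b) := fun a b =>
      Monotone.map_max fun _ _ h => mul_le_mul_right h _
    rw [bridgeSeminorm, bridgeSeminorm, hmax, hmax, hb, Prod.smul_fst, Prod.smul_snd,
      hX.isExtSeminorm_affSeminorm.smul, hY.isExtSeminorm_affSeminorm.smul]

lemma bridgeSeminorm_eq_zero_iff (hX : IsCompactConvexMetric X dX)
    (hY : IsCompactConvexMetric Y dY) (hc : 0 < c) (p : Aff X × Aff Y) :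
    bridgeSeminorm dX dY f c p = 0 ↔ ∃ r : ℝ, p = r • (Aff.unit X, Aff.unit Y) := by
  rw [← nonpos_iff_eq_zero, bridgeSeminorm_le_iff, nonpos_iff_eq_zero, nonpos_iff_eq_zero,
    hX.affSeminorm_eq_zero_iff, hY.affSeminorm_eq_zero_iff, ← ENNReal.ofReal_zero,
    bridge_le_iff hc le_rfl]
  constructor
  · rintro ⟨⟨r, hr⟩, ⟨s, hs⟩, h⟩
    obtain ⟨x₀, hx₀⟩ := hX.nonempty
    have h1 := h ⟨x₀, hx₀⟩
    rw [hr, hs] at h1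
    have h2 : r = s := by simpa [Aff.unit, sub_eq_zero] using h1
    exact ⟨r, Prod.ext hr (h2 ▸ hs)⟩
  · rintro ⟨r, rfl⟩
    exact ⟨⟨r, rfl⟩, ⟨r, rfl⟩, fun x => by simp [Aff.unit]⟩

lemma eq_of_stateDist_eq_zero {E : Type*} [AddCommGroup E] [Module ℝ E] [PartialOrder E] {e : E}
    {L : E → ℝ≥0∞} (hL : IsExtSeminorm ℝ L) {σ τ : StateSpace e} (h : stateDist e L σ τ = 0)
    {x : E} (hx : L x ≠ ∞) : σ.1 x = τ.1 x := by
  have hs : 0 < (L x).toReal + 1 := by positivity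
  have h1 : L (((L x).toReal + 1)⁻¹ • x) ≤ 1 := by
    rw [hL.smul, Real.enorm_eq_ofReal (inv_nonneg.2 hs.le)]
    calc _ ≤ ENNReal.ofReal ((L x).toReal + 1)⁻¹ * ENNReal.ofReal ((L x).toReal + 1) := by
          gcongr
          rw [ENNReal.le_ofReal_iff_toReal_le hx hs.le]
          linarith
      _ = 1 := by rw [← ENNReal.ofReal_mul (inv_nonneg.2 hs.le), inv_mul_cancel₀ hs.ne',
        ENNReal.ofReal_one]
  have h2 := abs_sub_le_of_stateDist_le le_rfl (by rw [h, ENNReal.ofReal_zero]) h1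
  rw [map_smul, map_smul, ← smul_sub, smul_eq_mul, abs_nonpos_iff, mul_eq_zero, sub_eq_zero] at h2
  exact h2.resolve_left (inv_pos.2 hs).ne'

lemma IsMetricBauerSimplex.isLipNorm_bridgeSeminorm (hX : IsMetricBauerSimplex X dX)
    (hY : IsMetricBauerSimplex Y dY) (hc : 0 < c) :
    IsLipNorm (Aff.unit X, Aff.unit Y) (bridgeSeminorm dX dY f c) where
  isExtSeminorm := isExtSeminorm_bridgeSeminorm hX.metrizedBy hY.metrizedBy hc
  eq_zero_iff := bridgeSeminorm_eq_zero_iff hX.toIsCompactConvexMetric hY.toIsCompactConvexMetric hc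
  inducesTopology := by
    have hL := isExtSeminorm_bridgeSeminorm (f := f) hX.metrizedBy hY.metrizedBy hc
    have := hX.compactSpace
    have := hY.compactSpace
    have hsurj := surjective_comboState hX.toIsCompactConvexMetric hY.toIsCompactConvexMetric
    obtain ⟨D, hD, hDY⟩ := hY.metrizedBy.exists_bound
    have hbound : ∀ p q : unitInterval × X × Y,
        stateDist (Aff.unit X, Aff.unit Y) (bridgeSeminorm dX dY f c) (comboState p)
          (comboState q) ≤ ENNReal.ofReal
            (|(p.1 : ℝ) - q.1| * (c + D) + dX p.2.1 q.2.1 + dY p.2.2 q.2.2) := by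
      rintro ⟨s, x, y⟩ ⟨t, x', y'⟩
      have hdX := hX.metrizedBy.nonneg x x'
      have hdY := hY.metrizedBy.nonneg y y'
      refine (stateDist_le_iff (by positivity)).2 fun u hu => ?_
      obtain ⟨h1, h2, h3⟩ := bridgeSeminorm_le_iff.1 hu
      rw [hX.metrizedBy.lipSeminorm_le_one_iff] at h1
      rw [hY.metrizedBy.lipSeminorm_le_one_iff] at h2
      rw [← ENNReal.ofReal_one, bridge_le_iff hc zero_le_one] at h3
      have e1 : (comboState (s, x, y)).1 u - (comboState (t, x', y')).1 u =
          ((s : ℝ) - t) * (u.1.1 x' - u.2.1 y') + s * (u.1.1 x - u.1.1 x') +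
            (1 - s) * (u.2.1 y - u.2.1 y') := by
        simp only [comboState_apply]
        ring
      have h4 : |u.1.1 x' - u.2.1 y'| ≤ c + D := by
        have h5 := abs_sub_le (u.1.1 x') (u.2.1 (f x')) (u.2.1 y')
        have h6 := h3 x'
        have h7 := (h2 (f x') y').trans (hDY _ _)
        rw [Real.norm_eq_abs] at h7
        linarith
      rw [e1]
      refine (abs_add_le _ _).trans (add_le_add ((abs_add_le _ _).trans (add_le_add ?_ ?_)) ?_)
      · rw [abs_mul]
        exact mul_le_mul_of_nonneg_left h4 (abs_nonneg _)
      · rw [abs_mul, abs_of_nonneg s.2.1]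
        exact (mul_le_of_le_one_left (abs_nonneg _) s.2.2).trans (h1 x x')
      · rw [abs_mul, abs_of_nonneg (sub_nonneg.2 s.2.2)]
        exact (mul_le_of_le_one_left (abs_nonneg _) (by linarith [s.2.1])).trans (h2 y y')
    refine inducesTopology_of_surjective continuous_comboState hsurj ?_ ?_
      stateDist_comm stateDist_triangle ?_
    · intro σ τ
      obtain ⟨p, rfl⟩ := hsurj σ
      obtain ⟨q, rfl⟩ := hsurj τ
      exact ((hbound p q).trans_lt ENNReal.ofReal_lt_top).ne
    · intro σ τ
      refine ⟨fun h => ?_, fun h => h ▸ stateDist_self σ⟩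
      obtain ⟨⟨s, x, y⟩, rfl⟩ := hsurj σ
      obtain ⟨⟨t, x', y'⟩, rfl⟩ := hsurj τ
      -- Every pair of Lipschitz affine functions has finite seminorm.
      have hfin : ∀ u : Aff X × Aff Y, affSeminorm dX u.1 ≠ ∞ → affSeminorm dY u.2 ≠ ∞ →
          bridgeSeminorm dX dY f c u ≠ ∞ := by
        intro u h1 h2
        have h3 : bridge f c u ≤ ENNReal.ofReal ((‖u.1.1‖ + ‖u.2.1‖) / c) :=
          (bridge_le_iff hc (by positivity)).2 fun z => by
            rw [div_mul_cancel₀ _ hc.ne']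
            exact (abs_sub _ _).trans
              (add_le_add (u.1.1.norm_coe_le_norm z) (u.2.1.norm_coe_le_norm (f z)))
        exact (max_lt (max_lt h1.lt_top h2.lt_top) (h3.trans_lt ENNReal.ofReal_lt_top)).ne
      have h0X : affSeminorm dX (0 : Aff X) ≠ ∞ := by
        rw [(hX.affSeminorm_eq_zero_iff 0).2 ⟨0, (zero_smul _ _).symm⟩]
        exact ENNReal.zero_ne_top
      have h0Y : affSeminorm dY (0 : Aff Y) ≠ ∞ := by
        rw [(hY.affSeminorm_eq_zero_iff 0).2 ⟨0, (zero_smul _ _).symm⟩]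
        exact ENNReal.zero_ne_top
      have h1X : affSeminorm dX (Aff.unit X) ≠ ∞ := by
        rw [(hX.affSeminorm_eq_zero_iff _).2 ⟨1, (one_smul _ _).symm⟩]
        exact ENNReal.zero_ne_top
      have hst : (s : ℝ) = t := by
        simpa [comboState_apply, Aff.unit] using
          eq_of_stateDist_eq_zero hL h (hfin (Aff.unit X, 0) h1X h0Y)
      have hxx : (s : ℝ) = 0 ∨ x = x' := by
        refine or_iff_not_imp_left.2 fun hs => ?_
        refine (hX.eq_zero_iff _ _).1 (le_antisymm (hX.dist_le_of_forall fun a ha => ?_)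
          (hX.metrizedBy.nonneg _ _))
        have h2 : affSeminorm dX a ≠ ∞ :=
          ((hX.metrizedBy.lipSeminorm_le_one_iff.2 ha).trans_lt ENNReal.one_lt_top).ne
        have h3 := eq_of_stateDist_eq_zero hL h (hfin (a, 0) h2 h0Y)
        have h4 : a.1 x = a.1 x' := by
          simpa [comboState_apply, ← hst, hs] using h3
        simp [h4]
      have hyy : 1 - (s : ℝ) = 0 ∨ y = y' := by
        refine or_iff_not_imp_left.2 fun hs => ?_
        refine (hY.eq_zero_iff _ _).1 (le_antisymm (hY.dist_le_of_forall fun a ha => ?_)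
          (hY.metrizedBy.nonneg _ _))
        have h2 : affSeminorm dY a ≠ ∞ :=
          ((hY.metrizedBy.lipSeminorm_le_one_iff.2 ha).trans_lt ENNReal.one_lt_top).ne
        have h3 := eq_of_stateDist_eq_zero hL h (hfin (0, a) h0X h2)
        have h4 : a.1 y = a.1 y' := by
          simpa [comboState_apply, ← hst, hs] using h3
        simp [h4]
      refine Subtype.ext (LinearMap.ext fun u => ?_)
      simp only [comboState_apply, ← hst]
      congr 1
      · rcases hxx with h | h <;> simp [h]
      · rcases hyy with h | h <;> simp [h]
    · intro p
      have hcont : Continuous fun q : unitInterval × X × Y => ENNReal.ofReal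
          (|(p.1 : ℝ) - q.1| * (c + D) + dX p.2.1 q.2.1 + dY p.2.2 q.2.2) := by
        have h1 : Continuous fun q : unitInterval × X × Y => dX p.2.1 q.2.1 :=
          hX.metrizedBy.continuous_dist.comp (f := fun q : unitInterval × X × Y => (p.2.1, q.2.1))
            (by fun_prop)
        have h2 : Continuous fun q : unitInterval × X × Y => dY p.2.2 q.2.2 :=
          hY.metrizedBy.continuous_dist.comp (f := fun q : unitInterval × X × Y => (p.2.2, q.2.2))
            (by fun_prop)
        have h3 : Continuous fun q : unitInterval × X × Y => |(p.1 : ℝ) - q.1| * (c + D) := by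
          fun_prop
        exact ENNReal.continuous_ofReal.comp ((h3.add h1).add h2)
      have hlim := hcont.tendsto p
      simp only [sub_self, abs_zero, zero_mul, hX.metrizedBy.self, hY.metrizedBy.self, add_zero,
        ENNReal.ofReal_zero] at hlim
      exact tendsto_of_tendsto_of_tendsto_of_le_of_le tendsto_const_nhds hlim
        (fun _ => zero_le) fun q => hbound p q

/-- Lipschitz affine functions are carried over along the approximate inverse `g` of an
`ε`-isometry `f`, and corrected. The error is `3 * ε` for the correction plus `2 * ε` for the
distance from `x` to `g (f x)`. -/
lemma IsMetricBauerSimplex.exists_bridge_left (hX : IsMetricBauerSimplex X dX)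
    (hY : IsMetricBauerSimplex Y dY) {ε : ℝ} (hε : 0 < ε)
    (hfi : ∀ x x', |dY (f x) (f x') - dX x x'| < ε) {g : Y → X} (hgc : Continuous g)
    (hga : IsAffine fun y => (g y : V₁)) (hfg : ∀ y, dY (f (g y)) y < ε) {a : Aff X} {t : ℝ}
    (ht : 0 ≤ t) (ha : affSeminorm dX a ≤ ENNReal.ofReal t) :
    ∃ k : Aff Y, affSeminorm dY k ≤ ENNReal.ofReal t ∧
      bridge f (5 * ε) (a, k) ≤ ENNReal.ofReal t := by
  have ha := (hX.metrizedBy.lipSeminorm_le_iff ht).1 ha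
  simp only [Real.norm_eq_abs] at ha
  have hu : ∀ y y', (Aff.comp a hgc hga).1 y - (Aff.comp a hgc hga).1 y' ≤
      t * dY y y' + t * (3 * ε) := by
    intro y y'
    have h1 : (Aff.comp a hgc hga).1 y - (Aff.comp a hgc hga).1 y' ≤ t * dX (g y) (g y') :=
      (le_abs_self _).trans (ha (g y) (g y'))
    have h2 := (abs_lt.1 (hfi (g y) (g y'))).1
    have h3 := hY.triangle (f (g y)) y (f (g y'))
    have h4 := hY.triangle y y' (f (g y'))
    have h5 := hfg y
    have h6 := hfg y'
    rw [hY.symm] at h6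
    have h7 : dX (g y) (g y') ≤ dY y y' + 3 * ε := by linarith
    exact h1.trans ((mul_le_mul_of_nonneg_left h7 ht).trans_eq (mul_add _ _ _))
  obtain ⟨k, hk, hka⟩ := hY.exists_lipschitz_aff_near _ ht hu
  refine ⟨k, hk, (bridge_le_iff (by positivity) ht).2 fun x => ?_⟩
  have h1 : |k.1 (f x) - a.1 (g (f x))| ≤ t * (3 * ε) := hka (f x)
  have h2 := ha x (g (f x))
  have h3 := (abs_lt.1 (hfi x (g (f x)))).1
  have h4 := hfg (f x)
  rw [hY.symm] at h4
  have h5 : t * dX x (g (f x)) ≤ t * (2 * ε) :=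
    mul_le_mul_of_nonneg_left (by linarith) ht
  have h6 := abs_sub_le (a.1 x) (a.1 (g (f x))) (k.1 (f x))
  rw [abs_sub_comm (a.1 (g (f x)))] at h6
  change |a.1 x - k.1 (f x)| ≤ _
  linarith

lemma IsMetricBauerSimplex.exists_bridge_right (hX : IsMetricBauerSimplex X dX)
    (hY : MetrizedBy dY) {ε : ℝ} (hε : 0 < ε)
    (hfi : ∀ x x', |dY (f x) (f x') - dX x x'| < ε) (hfc : Continuous f)
    (hfa : IsAffine fun x => (f x : V₂)) {k : Aff Y} {t : ℝ}
    (ht : 0 ≤ t) (hk : affSeminorm dY k ≤ ENNReal.ofReal t) :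
    ∃ a : Aff X, affSeminorm dX a ≤ ENNReal.ofReal t ∧
      bridge f (5 * ε) (a, k) ≤ ENNReal.ofReal t := by
  have hk := (hY.lipSeminorm_le_iff ht).1 hk
  simp only [Real.norm_eq_abs] at hk
  have hu : ∀ x x', (Aff.comp k hfc hfa).1 x - (Aff.comp k hfc hfa).1 x' ≤
      t * dX x x' + t * ε := by
    intro x x'
    have h1 : (Aff.comp k hfc hfa).1 x - (Aff.comp k hfc hfa).1 x' ≤ t * dY (f x) (f x') :=
      (le_abs_self _).trans (hk (f x) (f x'))
    have h2 := (abs_lt.1 (hfi x x')).2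
    have h7 : dY (f x) (f x') ≤ dX x x' + ε := by linarith
    exact h1.trans ((mul_le_mul_of_nonneg_left h7 ht).trans_eq (mul_add _ _ _))
  obtain ⟨a, ha, hak⟩ := hX.exists_lipschitz_aff_near _ ht hu
  refine ⟨a, ha, (bridge_le_iff (by positivity) ht).2 fun x => (hak x).trans ?_⟩
  exact mul_le_mul_of_nonneg_left (by linarith) ht

/-- An `ε`-isometry gives an admissible Lip-norm whose bridge has length `5 * ε`. -/
lemma IsMetricBauerSimplex.isAdmissible_bridgeSeminorm (hX : IsMetricBauerSimplex X dX)
    (hY : IsMetricBauerSimplex Y dY) {ε : ℝ} (hε : 0 < ε) (hf : f ∈ epsIsom ε X dX Y dY) :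
    IsAdmissible (Aff.unit X) (affSeminorm dX) (Aff.unit Y) (affSeminorm dY)
      (bridgeSeminorm dX dY f (5 * ε)) := by
  obtain ⟨hfc, hfa, hfi, g, hgc, hga, hfg⟩ := hf
  have hlip := hX.isLipNorm_bridgeSeminorm (f := f) hY (show 0 < 5 * ε by positivity)
  refine ⟨hlip, fun a => ?_, fun k => ?_⟩
  · refine le_antisymm (le_iInf fun k => affSeminorm_left_le_bridgeSeminorm a k) ?_
    rcases eq_or_ne (affSeminorm dX a) ∞ with h | h
    · rw [h]
      exact le_top
    · obtain ⟨k, h1, h2⟩ := hX.exists_bridge_left hY hε hfi hgc hga hfg ENNReal.toReal_nonneg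
        (ENNReal.ofReal_toReal h).ge
      rw [ENNReal.ofReal_toReal h] at h1 h2
      exact iInf_le_of_le k (bridgeSeminorm_mk_le le_rfl h1 h2)
  · refine le_antisymm (le_iInf fun a => affSeminorm_right_le_bridgeSeminorm a k) ?_
    rcases eq_or_ne (affSeminorm dY k) ∞ with h | h
    · rw [h]
      exact le_top
    · obtain ⟨a, h1, h2⟩ := hX.exists_bridge_right hY.metrizedBy hε hfi hfc hfa
        ENNReal.toReal_nonneg (ENNReal.ofReal_toReal h).ge
      rw [ENNReal.ofReal_toReal h] at h1 h2
      exact iInf_le_of_le a (bridgeSeminorm_mk_le h1 le_rfl h2)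

lemma MetrizedBy.stateDist_bridgeSeminorm_le (hY : MetrizedBy dY) (hc : 0 < c) (x : X) (y : Y) :
    stateDist (Aff.unit X, Aff.unit Y) (bridgeSeminorm dX dY f c)
      (StateSpace.inl (Aff.unit X) (Aff.unit Y) (evalState x))
      (StateSpace.inr (Aff.unit X) (Aff.unit Y) (evalState y)) ≤
        ENNReal.ofReal (c + dY (f x) y) := by
  have hd := hY.nonneg (f x) y
  refine (stateDist_le_iff (by positivity)).2 fun u hu => ?_
  obtain ⟨-, h2, h3⟩ := bridgeSeminorm_le_iff.1 hu
  rw [← ENNReal.ofReal_one, bridge_le_iff hc zero_le_one, one_mul] at h3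
  have h4 := h3 x
  have h5 : |u.2.1 (f x) - u.2.1 y| ≤ dY (f x) y := hY.lipSeminorm_le_one_iff.1 h2 _ _
  have h6 := abs_sub_le (u.1.1 x) (u.2.1 (f x)) (u.2.1 y)
  change |u.1.1 x - u.2.1 y| ≤ _
  linarith

/-- Points that correspond under an `ε`-isometry or its approximate inverse are at distance less
than `6 * ε`, hence the Hausdorff distance is less than `7 * ε`. -/
lemma IsMetricBauerSimplex.quantumDist_le (hX : IsMetricBauerSimplex X dX)
    (hY : IsMetricBauerSimplex Y dY) {ε : ℝ} (hε : 0 < ε) (h : (epsIsom ε X dX Y dY).Nonempty) :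
    quantumDist (Aff.unit X) (affSeminorm dX) (Aff.unit Y) (affSeminorm dY) ≤
      ENNReal.ofReal (7 * ε) := by
  obtain ⟨f, hf⟩ := h
  have hadm := hX.isAdmissible_bridgeSeminorm hY hε hf
  obtain ⟨-, -, -, g, -, -, hfg⟩ := hf
  have hc : 0 < 5 * ε := by positivity
  have hlt : ∀ x y, dY (f x) y < ε → stateDist (Aff.unit X, Aff.unit Y)
      (bridgeSeminorm dX dY f (5 * ε)) (StateSpace.inl (Aff.unit X) (Aff.unit Y) (evalState x))
      (StateSpace.inr (Aff.unit X) (Aff.unit Y) (evalState y)) < ENNReal.ofReal (7 * ε) :=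
    fun x y hxy => (hY.metrizedBy.stateDist_bridgeSeminorm_le hc x y).trans_lt
      ((ENNReal.ofReal_lt_ofReal_iff (by positivity)).2 (by linarith))
  refine iInf₂_le_of_le _ hadm (sInf_le ⟨by simpa using hε, fun σ => ?_, fun τ => ?_⟩)
  · obtain ⟨x, rfl⟩ := exists_eq_evalState hX.isCompact hX.convex σ
    exact ⟨evalState (f x), hlt x (f x) (by rwa [hY.metrizedBy.self])⟩
  · obtain ⟨y, rfl⟩ := exists_eq_evalState hY.isCompact hY.convex τ
    exact ⟨evalState (g y), hlt (g y) y (hfg y)⟩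

end Bridge

lemma MetricBauerSimplex.qdist_le_gap (X Y : MetricBauerSimplex.{u}) :
    X.qdist Y ≤ 7 * X.gap Y := by
  rcases eq_or_ne (X.gap Y) ∞ with h | h
  · simp [h]
  obtain ⟨a, ha⟩ := WithTop.ne_top_iff_exists.1 h
  refine ENNReal.le_of_forall_pos_le_add fun ε hε _ => ?_
  have hpos : (0 : ℝ) < ((a + ε / 7 : NNReal) : ℝ) := by positivity
  have hlt : X.gap Y < ENNReal.ofReal ((a + ε / 7 : NNReal) : ℝ) := by
    rw [← ha, ENNReal.ofReal_coe_nnreal]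
    exact ENNReal.coe_lt_coe.2 (lt_add_of_pos_right a (by positivity))
  refine (X.isMetricBauerSimplex.quantumDist_le Y.isMetricBauerSimplex hpos
    (nonempty_epsIsom_of_gap_lt hlt).1).trans_eq ?_
  rw [← ha]
  have : 7 * ((a + ε / 7 : NNReal) : ℝ) = ((7 * a + ε : NNReal) : ℝ) := by
    push_cast
    ring
  rw [this, ENNReal.ofReal_coe_nnreal]
  push_cast
  rfl

lemma MetricBauerSimplex.tendsto_gap_iff_tendsto_qdist (X : ℕ → MetricBauerSimplex.{u})
    (Z : MetricBauerSimplex.{u}) : Tendsto (fun n => (X n).gap Z) atTop (𝓝 0) ↔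
      Tendsto (fun n => (X n).qdist Z) atTop (𝓝 0) := by
  constructor <;> intro h
  · have h' := ENNReal.Tendsto.const_mul h (Or.inr (ENNReal.ofNat_ne_top (n := 7)))
    rw [mul_zero] at h'
    exact tendsto_of_tendsto_of_tendsto_of_le_of_le tendsto_const_nhds h' (fun _ => zero_le)
      fun n => (X n).qdist_le_gap Z
  · have h' := ENNReal.Tendsto.const_mul h (Or.inr (ENNReal.ofNat_ne_top (n := 2)))
    rw [mul_zero] at h'
    exact tendsto_of_tendsto_of_tendsto_of_le_of_le tendsto_const_nhds h' (fun _ => zero_le)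
      fun n => (X n).gap_le_qdist Z

/-! ### Transport of the Bauer simplex structure along affine isometries -/

section Transport

universe u₁ u₂

variable {V₁ : Type u₁} [AddCommGroup V₁] [Module ℝ V₁]
  {X : Set V₁} {dX : X → X → ℝ}
  {V₂ : Type u₂} [AddCommGroup V₂] [Module ℝ V₂]
  {Y : Set V₂} {dY : Y → Y → ℝ}

lemma AffineIsometry.mem_extremePoints (φ : AffineIsometry X dX Y dY) (hX : Convex ℝ X) {x : X}
    (hx : (x : V₁) ∈ X.extremePoints ℝ) : (φ.toEquiv x : V₂) ∈ Y.extremePoints ℝ := by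
  refine ⟨(φ.toEquiv x).2, fun y₁ hy₁ y₂ hy₂ hseg => ?_⟩
  obtain ⟨a, b, ha, hb, hab, h⟩ := hseg
  have h1 := (φ.symm hX).affine ⟨y₁, hy₁⟩ ⟨y₂, hy₂⟩ (φ.toEquiv x) a b ha.le hb.le hab h.symm
  have h2 : (φ.symm hX).toEquiv (φ.toEquiv x) = x := φ.toEquiv.symm_apply_apply x
  simp only [h2] at h1
  have h3 := hx.2 ((φ.symm hX).toEquiv ⟨y₁, hy₁⟩).2 ((φ.symm hX).toEquiv ⟨y₂, hy₂⟩).2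
    ⟨a, b, ha, hb, hab, h1.symm⟩
  have h4 : φ.toEquiv.symm ⟨y₁, hy₁⟩ = x := Subtype.ext h3
  rw [← h4, Equiv.apply_symm_apply]

lemma AffineIsometry.convex (φ : AffineIsometry X dX Y dY) (hX : Convex ℝ X) : Convex ℝ Y := by
  intro y₁ hy₁ y₂ hy₂ a b ha hb hab
  have h := φ.affine (φ.toEquiv.symm ⟨y₁, hy₁⟩) (φ.toEquiv.symm ⟨y₂, hy₂⟩)
    ⟨_, hX (φ.toEquiv.symm ⟨y₁, hy₁⟩).2 (φ.toEquiv.symm ⟨y₂, hy₂⟩).2 ha hb hab⟩ a b ha hb hab rfl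
  simp only [Equiv.apply_symm_apply] at h
  rw [← h]
  exact Subtype.coe_prop _

lemma wasserstein_map {K : Type u} {K' : Type v} [MeasurableSpace K] [MeasurableSpace K']
    {d : K → K → ℝ} {d' : K' → K' → ℝ} (b : K ≃ᵐ K') (hb : ∀ e e', d' (b e) (b e') = d e e')
    (μ ν : ProbabilityMeasure K) :
    wasserstein d' (μ.map b.measurable.aemeasurable) (ν.map b.measurable.aemeasurable) =
      wasserstein d μ ν := by
  refine Function.Surjective.iSup_congr (fun f : K' → ℝ => f ∘ b)
    (fun g => ⟨g ∘ b.symm, funext fun e => congrArg g (b.symm_apply_apply e)⟩) fun f => ?_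
  refine iSup_congr_Prop ?_ fun _ => ?_
  · rw [b.surjective.forall₂]
    simp only [hb, Function.comp_apply]
  · congr 3
    · exact (integral_map_equiv b f).symm
    · exact (integral_map_equiv b f).symm

variable [TopologicalSpace V₁] [TopologicalSpace V₂]

/-- The restriction of an affine homeomorphism to the extremal boundaries. -/
def AffineIsometry.boundaryHomeomorph (φ : AffineIsometry X dX Y dY) (hX : Convex ℝ X)
    (hφ : Continuous φ.toEquiv) (hφ' : Continuous φ.toEquiv.symm) :
    Boundary X ≃ₜ Boundary Y where
  toFun e := ⟨φ.toEquiv e.incl, φ.mem_extremePoints hX e.2⟩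
  invFun e := ⟨φ.toEquiv.symm e.incl, (φ.symm hX).mem_extremePoints (φ.convex hX) e.2⟩
  left_inv e := Boundary.isEmbedding_incl.injective (φ.toEquiv.symm_apply_apply e.incl)
  right_inv e := Boundary.isEmbedding_incl.injective (φ.toEquiv.apply_symm_apply e.incl)
  continuous_toFun := Boundary.isEmbedding_incl.continuous_iff.2
    (hφ.comp Boundary.continuous_incl)
  continuous_invFun := Boundary.isEmbedding_incl.continuous_iff.2
    (hφ'.comp Boundary.continuous_incl)

lemma Represents.map {μ : ProbabilityMeasure (Boundary X)} {x : X} (hμ : Represents μ x)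
    {f : X → Y} (hf : Continuous f) (hfa : IsAffine fun x => (f x : V₂))
    {b : Boundary X → Boundary Y} (hb : Continuous b) (hbf : ∀ e, (b e).incl = f e.incl) :
    Represents (μ.map hb.measurable.aemeasurable) (f x) := by
  intro k
  have h1 := hμ (Aff.comp k hf hfa)
  have h2 : ∫ e, k.1 e.incl ∂((μ : Measure (Boundary X)).map b) =
      ∫ e, k.1 (b e).incl ∂(μ : Measure (Boundary X)) :=
    integral_map hb.measurable.aemeasurable (Aff.restrict k).continuous.aestronglyMeasurable
  simp only [hbf] at h2
  exact h1.trans h2.symm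

/-- An affine isometric homeomorphism carries metric Bauer simplices to metric Bauer simplices. -/
lemma IsMetricBauerSimplex.of_affineIsometry (hX : IsMetricBauerSimplex X dX)
    (φ : AffineIsometry X dX Y dY) (hφ : Continuous φ.toEquiv)
    (hφ' : Continuous φ.toEquiv.symm) : IsMetricBauerSimplex Y dY := by
  have hcX := hX.compactSpace
  have hd : ∀ y y', dY y y' = dX (φ.toEquiv.symm y) (φ.toEquiv.symm y') := fun y y' =>
    ((φ.symm hX.convex).isometric y y').symm
  let b := φ.boundaryHomeomorph hX.convex hφ hφ'
  have hb : ∀ e, (b e).incl = φ.toEquiv e.incl := fun _ => rfl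
  have hb' : ∀ e, (b.symm e).incl = φ.toEquiv.symm e.incl := fun _ => rfl
  have hrep : ∀ {μ : ProbabilityMeasure (Boundary Y)} {y : Y}, Represents μ y →
      Represents (μ.map b.symm.continuous.measurable.aemeasurable) (φ.toEquiv.symm y) :=
    fun hμ => hμ.map hφ' (φ.symm hX.convex).affine b.symm.continuous hb'
  refine
    { nonempty := ?_
      isCompact := ?_
      convex := φ.convex hX.convex
      eq_zero_iff := fun y y' => ?_
      symm := fun y y' => ?_
      triangle := fun y y' y'' => ?_
      mem_nhds_iff := fun y s => ?_
      existsUnique_represents := fun y => ?_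
      isCompact_extremePoints := ?_
      dist_eq_wasserstein := fun y y' μ ν hμ hν => ?_ }
  · obtain ⟨x, hx⟩ := hX.nonempty
    exact ⟨_, (φ.toEquiv ⟨x, hx⟩).2⟩
  · have h := isCompact_range (continuous_subtype_val.comp hφ)
    rwa [range_comp, φ.toEquiv.surjective.range_eq, image_univ, Subtype.range_coe] at h
  · rw [hd, hX.eq_zero_iff, φ.toEquiv.symm.injective.eq_iff]
  · rw [hd, hd, hX.symm]
  · rw [hd, hd, hd]
    exact hX.triangle _ _ _
  · let ψ : Y ≃ₜ X := ⟨φ.toEquiv.symm, hφ', hφ⟩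
    rw [ψ.isInducing.nhds_eq_comap, mem_comap]
    constructor
    · rintro ⟨t, ht, hts⟩
      obtain ⟨ε, hε, h⟩ := (hX.mem_nhds_iff _ _).1 ht
      refine ⟨ε, hε, fun z hz => hts (h ?_)⟩
      exact (hd y z).symm.trans_lt hz
    · rintro ⟨ε, hε, h⟩
      refine ⟨_, (hX.mem_nhds_iff _ _).2 ⟨ε, hε, subset_rfl⟩, fun z hz => h ?_⟩
      exact (hd y z).trans_lt hz
  · refine ⟨(hX.reprMeasure (φ.toEquiv.symm y)).map b.continuous.measurable.aemeasurable, ?_, ?_⟩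
    · have h := (hX.represents_reprMeasure (φ.toEquiv.symm y)).map hφ φ.affine b.continuous hb
      rwa [Equiv.apply_symm_apply] at h
    · intro ν hν
      have h : _ = hX.reprMeasure (φ.toEquiv.symm y) := hX.eq_reprMeasure (hrep hν)
      refine Subtype.ext ?_
      rw [← h]
      change (ν : Measure (Boundary Y)) = ((ν : Measure (Boundary Y)).map b.symm).map b
      rw [Measure.map_map b.continuous.measurable b.symm.continuous.measurable]
      simp
  · have := hX.compactSpace_boundary
    exact isCompact_iff_compactSpace.2 b.compactSpace
  · rw [hd, hX.dist_eq_wasserstein _ _ _ _ (hrep hμ) (hrep hν)]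
    exact wasserstein_map b.symm.toMeasurableEquiv
      (d := fun e e' : Boundary Y => dY e.incl e'.incl) (fun e e' => by
        rw [hd]
        rfl) μ ν

end Transport

/-! ### Tracial states of `C(∂ₑX)` -/

section Traces

variable {K : Type u} [TopologicalSpace K]

/-- A real continuous function, regarded as a complex one. -/
def toComplex (u : C(K, ℝ)) : C(K, ℂ) := ⟨fun e => u e, Complex.continuous_ofReal.comp u.continuous⟩

@[simp] lemma toComplex_apply (u : C(K, ℝ)) (e : K) : toComplex u e = u e := rfl

/-- The real part of a complex continuous function. -/
def rePart (a : C(K, ℂ)) : C(K, ℝ) := ⟨fun e => (a e).re, Complex.continuous_re.comp a.continuous⟩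

/-- The imaginary part of a complex continuous function. -/
def imPart (a : C(K, ℂ)) : C(K, ℝ) := ⟨fun e => (a e).im, Complex.continuous_im.comp a.continuous⟩

lemma eq_toComplex_rePart_add (a : C(K, ℂ)) :
    a = toComplex (rePart a) + Complex.I • toComplex (imPart a) := by
  ext e
  simp [rePart, imPart, mul_comm Complex.I, Complex.re_add_im]

lemma exists_star_mul_self_eq {u : C(K, ℝ)} (hu : ∀ e, 0 ≤ u e) :
    ∃ b : C(K, ℂ), toComplex u = star b * b := by
  refine ⟨toComplex ⟨fun e => √(u e), u.continuous.sqrt⟩, ?_⟩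
  ext e
  simp only [toComplex_apply, ContinuousMap.mul_apply, ContinuousMap.star_apply,
    ContinuousMap.coe_mk, RCLike.star_def, Complex.conj_ofReal]
  rw [← Complex.ofReal_mul, Real.mul_self_sqrt (hu e)]

variable [CompactSpace K]

lemma traces_nonneg {τ : WeakDual ℂ C(K, ℂ)} (hτ : τ ∈ traces C(K, ℂ)) {u : C(K, ℝ)}
    (hu : ∀ e, 0 ≤ u e) : 0 ≤ τ (toComplex u) := by
  obtain ⟨b, hb⟩ := exists_star_mul_self_eq hu
  rw [hb]
  exact hτ.2.1 b

/-- Traces are real on real functions, since adding the constant `‖u‖` to `u` makes it positive. -/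
lemma traces_im_eq_zero {τ : WeakDual ℂ C(K, ℂ)} (hτ : τ ∈ traces C(K, ℂ)) (u : C(K, ℝ)) :
    (τ (toComplex u)).im = 0 := by
  have h1 := traces_nonneg hτ (u := u + ContinuousMap.const K ‖u‖) fun e => by
    have := neg_le_of_abs_le (u.norm_coe_le_norm e)
    simp only [ContinuousMap.add_apply, ContinuousMap.const_apply]
    linarith
  have h2 : toComplex (u + ContinuousMap.const K ‖u‖) =
      toComplex u + ((‖u‖ : ℝ) : ℂ) • (1 : C(K, ℂ)) := by
    ext e
    simp
  rw [h2, map_add, map_smul, hτ.1] at h1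
  simpa using (Complex.nonneg_iff.1 h1).2.symm

/-- In a commutative algebra the two series defining an element of `A₀` have the same terms. -/
lemma cpNull_eq : cpNull C(K, ℂ) = {0} := by
  ext c
  constructor
  · rintro ⟨x, a, b, ha, hb, rfl⟩
    simp only [mul_comm (x _)] at hb
    simp [ha.unique hb]
  · rintro rfl
    exact ⟨0, 0, 0, by simp, by simp, by simp⟩

end Traces

section BauerTraces

variable {V : Type u} [AddCommGroup V] [Module ℝ V] [TopologicalSpace V] {X : Set V}
  {d : X → X → ℝ}

namespace IsMetricBauerSimplex

lemma integral_reprMeasure_complex (hX : IsMetricBauerSimplex X d) (a : C(Boundary X, ℂ)) (x : X) :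
    ∫ e, a e ∂(hX.reprMeasure x : Measure (Boundary X)) =
      (hX.affExtend (rePart a)).1 x + (hX.affExtend (imPart a)).1 x * Complex.I :=
  (integral_re_add_im (hX.integrable a.continuous (hX.reprMeasure x))).symm

lemma affExtend_restrict (hX : IsMetricBauerSimplex X d) (h : Aff X) :
    hX.affExtend (Aff.restrict h) = h :=
  Subtype.ext (ContinuousMap.ext fun x => (hX.represents_reprMeasure x h).symm)

lemma restrict_affExtend (hX : IsMetricBauerSimplex X d) (u : C(Boundary X, ℝ)) :
    Aff.restrict (hX.affExtend u) = u :=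
  ContinuousMap.ext fun e => hX.integral_reprMeasure_incl u e

variable [CompactSpace (Boundary X)]

/-- Integration against the representing measure of `x`, as a tracial state of `C(∂ₑX)`. -/
def trace (hX : IsMetricBauerSimplex X d) (x : X) : traces C(Boundary X, ℂ) :=
  ⟨StrongDual.toWeakDual (LinearMap.mkContinuous
    { toFun := fun a : C(Boundary X, ℂ) => ∫ e, a e ∂(hX.reprMeasure x : Measure (Boundary X))
      map_add' := fun a b => integral_add (hX.integrable a.continuous _)
        (hX.integrable b.continuous _)
      map_smul' := fun c a => integral_const_mul c _ } 1 fun a => by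
        rw [one_mul]
        simpa using norm_integral_le_of_norm_le_const
          (μ := (hX.reprMeasure x : Measure (Boundary X)))
          (Eventually.of_forall a.norm_coe_le_norm)), by
    refine ⟨?_, fun a => ?_, fun a b => ?_⟩
    · change ∫ e, (1 : ℂ) ∂(hX.reprMeasure x : Measure (Boundary X)) = 1
      simp
    · change 0 ≤ ∫ e, star (a e) * a e ∂(hX.reprMeasure x : Measure (Boundary X))
      have : ∀ e, star (a e) * a e = ((‖a e‖ ^ 2 : ℝ) : ℂ) := fun e => by
        rw [RCLike.star_def, Complex.conj_mul']
        push_cast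
        rfl
      simp only [this]
      rw [integral_complex_ofReal]
      exact Complex.zero_le_real.2 (integral_nonneg fun e => by positivity)
    · rw [mul_comm]⟩

lemma trace_apply (hX : IsMetricBauerSimplex X d) (x : X) (a : C(Boundary X, ℂ)) :
    (hX.trace x : WeakDual ℂ C(Boundary X, ℂ)) a =
      ∫ e, a e ∂(hX.reprMeasure x : Measure (Boundary X)) := rfl

lemma trace_toComplex (hX : IsMetricBauerSimplex X d) (x : X) (u : C(Boundary X, ℝ)) :
    (hX.trace x : WeakDual ℂ C(Boundary X, ℂ)) (toComplex u) = (hX.affExtend u).1 x :=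
  integral_complex_ofReal

/-- A tracial state restricts to a state of `Aff(X)`, which is evaluation at a point; since every
continuous function on the boundary extends to an affine one, the trace is recovered. -/
lemma surjective_trace (hX : IsMetricBauerSimplex X d) : Function.Surjective hX.trace := by
  rintro ⟨τ, hτ⟩
  let φ : StateSpace (Aff.unit X) :=
    ⟨{ toFun := fun h => (τ (toComplex (Aff.restrict h))).re
       map_add' := fun h k => by
        have : toComplex (Aff.restrict (h + k)) =
            toComplex (Aff.restrict h) + toComplex (Aff.restrict k) := by
          ext e
          simp [Aff.restrict]
        rw [this, map_add, Complex.add_re]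
       map_smul' := fun c h => by
        have : toComplex (Aff.restrict (c • h)) = (c : ℂ) • toComplex (Aff.restrict h) := by
          ext e
          simp [Aff.restrict]
        rw [this, map_smul, smul_eq_mul, Complex.re_ofReal_mul]
        rfl }, fun h hh => (Complex.nonneg_iff.1 (traces_nonneg hτ fun e => hh e.incl)).1, by
      have : toComplex (Aff.restrict (Aff.unit X)) = 1 := by
        ext e
        simp [Aff.restrict, Aff.unit]
      change (τ (toComplex (Aff.restrict (Aff.unit X)))).re = 1
      rw [this, hτ.1, Complex.one_re]⟩
  obtain ⟨x, hx⟩ := exists_eq_evalState hX.isCompact hX.convex φ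
  have hreal : ∀ u : C(Boundary X, ℝ),
      (hX.trace x : WeakDual ℂ C(Boundary X, ℂ)) (toComplex u) = τ (toComplex u) := by
    intro u
    have h1 : (τ (toComplex (Aff.restrict (hX.affExtend u)))).re = (hX.affExtend u).1 x :=
      congrArg (fun σ : StateSpace (Aff.unit X) => σ.1 (hX.affExtend u)) hx
    rw [hX.restrict_affExtend] at h1
    rw [hX.trace_toComplex, ← h1]
    exact Complex.ext rfl (by rw [Complex.ofReal_im, traces_im_eq_zero hτ])
  refine ⟨x, Subtype.ext (DFunLike.ext _ _ fun a => ?_)⟩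
  rw [eq_toComplex_rePart_add a, map_add, map_add, map_smul, map_smul, hreal, hreal]

lemma continuous_trace (hX : IsMetricBauerSimplex X d) : Continuous hX.trace := by
  refine Continuous.subtype_mk (WeakDual.continuous_of_continuous_eval fun a => ?_) _
  change Continuous fun x => ∫ e, a e ∂(hX.reprMeasure x : Measure (Boundary X))
  simp only [hX.integral_reprMeasure_complex]
  have h1 := (hX.affExtend (rePart a)).1.continuous
  have h2 := (hX.affExtend (imPart a)).1.continuous
  fun_prop

lemma isAffine_trace (hX : IsMetricBauerSimplex X d) :
    IsAffine fun x => (hX.trace x : WeakDual ℂ C(Boundary X, ℂ)) := by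
  intro x y z s t hs ht hst hz
  refine DFunLike.ext _ _ fun a => ?_
  exact hX.integral_reprMeasure_combo a.continuous hs ht hst hz

/-- The Lipschitz seminorm of the boundary metric on `C(∂ₑX)`. -/
abbrev boundarySeminorm (d : X → X → ℝ) (a : C(Boundary X, ℂ)) : ℝ≥0∞ :=
  lipSeminorm (fun e e' => d e.incl e'.incl) a

/-- The identification of `X` with the tracial state space of `C(∂ₑX)` is isometric. For complex
functions, the bound follows from the real case by rotating the difference of the integrals to the
positive real axis. -/
lemma traceEDist_trace (hX : IsMetricBauerSimplex X d) (x y : X) :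
    traceEDist (boundarySeminorm d) (hX.trace x) (hX.trace y) = ENNReal.ofReal (d x y) := by
  have hd := hX.metrizedBy
  have hle : traceEDist (boundarySeminorm d) (hX.trace x) (hX.trace y) ≤
      ENNReal.ofReal (d x y) := by
    refine iSup₂_le fun a ha => ENNReal.ofReal_le_ofReal ?_
    rw [hX.metrizedBy_boundary.lipSeminorm_le_one_iff] at ha
    set z := (hX.trace x : WeakDual ℂ C(Boundary X, ℂ)) a -
      (hX.trace y : WeakDual ℂ C(Boundary X, ℂ)) a with hz
    let u : C(Boundary X, ℝ) := rePart (star z • a)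
    have hu : ∀ w : X, (hX.affExtend u).1 w =
        (star z * (hX.trace w : WeakDual ℂ C(Boundary X, ℂ)) a).re := by
      intro w
      have h1 := hX.integral_reprMeasure_complex (star z • a) w
      have h2 : ∫ e, (star z • a) e ∂(hX.reprMeasure w : Measure (Boundary X)) =
          star z * (hX.trace w : WeakDual ℂ C(Boundary X, ℂ)) a := integral_const_mul _ _
      rw [← h2, h1]
      simp [u]
    have hlip : ∀ e e', |u e - u e'| ≤ ‖z‖ * d e.incl e'.incl := by
      intro e e'
      have h1 : u e - u e' = (star z * (a e - a e')).re := by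
        rw [mul_sub, Complex.sub_re]
        rfl
      rw [h1]
      refine (Complex.abs_re_le_norm _).trans ?_
      rw [norm_mul, norm_star]
      exact mul_le_mul_of_nonneg_left (ha e e') (norm_nonneg _)
    have h1 := hX.abs_integral_sub_le (norm_nonneg z) hlip x y
    rw [← hX.affExtend_apply, ← hX.affExtend_apply, hu, hu, ← Complex.sub_re, ← mul_sub, ← hz,
      RCLike.star_def, Complex.conj_mul', ← Complex.ofReal_pow, Complex.ofReal_re,
      abs_of_nonneg (by positivity), sq] at h1
    rcases (norm_nonneg z).eq_or_lt with h0 | h0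
    · rw [← h0]
      exact hd.nonneg x y
    · exact le_of_mul_le_mul_left h1 h0
  refine le_antisymm hle (ENNReal.ofReal_le_of_le_toReal (hX.dist_le_of_forall fun h hh => ?_))
  refine (ENNReal.ofReal_le_iff_le_toReal (hle.trans_lt ENNReal.ofReal_lt_top).ne).1 ?_
  have hL : boundarySeminorm d (toComplex (Aff.restrict h)) ≤ 1 :=
    hX.metrizedBy_boundary.lipSeminorm_le_one_iff.2 fun e e' => by
      rw [toComplex_apply, toComplex_apply, ← Complex.ofReal_sub, Complex.norm_real]
      exact hh _ _
  refine le_iSup₂_of_le (toComplex (Aff.restrict h)) hL (ENNReal.ofReal_le_ofReal ?_)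
  rw [hX.trace_toComplex, hX.trace_toComplex, hX.affExtend_restrict, ← Complex.ofReal_sub,
    Complex.norm_real]
  exact le_rfl

lemma traceDist_trace (hX : IsMetricBauerSimplex X d) (x y : X) :
    traceDist (boundarySeminorm d) (hX.trace x) (hX.trace y) = d x y := by
  rw [traceDist, hX.traceEDist_trace, ENNReal.toReal_ofReal (hX.metrizedBy.nonneg x y)]

lemma injective_trace (hX : IsMetricBauerSimplex X d) : Function.Injective hX.trace :=
  fun x y h => (hX.eq_zero_iff x y).1 <| by
    rw [← hX.traceDist_trace, h, hX.traceDist_trace, hX.metrizedBy.self]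

/-- A metric Bauer simplex is affinely isometric to the tracial state space of `C(∂ₑX)`. -/
def traceIsometry (hX : IsMetricBauerSimplex X d) :
    AffineIsometry X d (traces C(Boundary X, ℂ)) (traceDist (boundarySeminorm d)) where
  toEquiv := Equiv.ofBijective hX.trace ⟨hX.injective_trace, hX.surjective_trace⟩
  affine := hX.isAffine_trace
  isometric := hX.traceDist_trace

lemma isMetricBauerSimplex_traces (hX : IsMetricBauerSimplex X d) :
    IsMetricBauerSimplex (traces C(Boundary X, ℂ)) (traceDist (boundarySeminorm d)) := by
  have := hX.compactSpace
  have hc : Continuous hX.traceIsometry.toEquiv := hX.continuous_trace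
  exact hX.of_affineIsometry hX.traceIsometry hc (hc.homeoOfEquivCompactToT2).symm.continuous

/-- `C(∂ₑX)` with the Lipschitz seminorm is a quantum metric Bauer simplex. -/
lemma isCStarQMBS (hX : IsMetricBauerSimplex X d) : IsCStarQMBS (boundarySeminorm d) := by
  have hd := hX.metrizedBy_boundary
  have := hX.compactSpace
  have := hd.t2Space
  have := hd.secondCountableTopology
  refine
    { separable := inferInstanceAs (TopologicalSpace.SeparableSpace C(Boundary X, ℂ))
      isExtSeminorm := ⟨fun a b => lipSeminorm_add_le hd.nonneg a b,
        fun c a => lipSeminorm_smul _ c a⟩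
      isTraciallyOrdered := ⟨?_, fun a ha => ⟨?_, fun h => ?_⟩⟩
      selfAdjoint := fun a => ?_
      lowerSemicontinuous := ?_
      denselyFinite := ?_
      eq_zero_iff := fun a => ?_
      inducesTopology := hX.metrizedBy.inducesTopology hX.continuous_trace hX.surjective_trace
        hX.traceEDist_trace
      isMetricBauerSimplex := hX.isMetricBauerSimplex_traces }
  · obtain ⟨x, hx⟩ := hX.nonempty
    exact ⟨_, (hX.trace ⟨x, hx⟩).2⟩
  · rintro ⟨b, hb⟩ τ hτ
    rw [cpNull_eq, mem_singleton_iff, sub_eq_zero] at hb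
    rw [hb]
    exact hτ.2.1 b
  · have hval : ∀ e, 0 ≤ a e := fun e => by
      have h1 := h _ (hX.trace e.incl).2
      rwa [hX.trace_apply, hX.integral_reprMeasure_incl a e] at h1
    have ha' : a = toComplex (rePart a) := by
      ext e
      exact Complex.ext rfl (Complex.nonneg_iff.1 (hval e)).2.symm
    obtain ⟨b, hb⟩ := exists_star_mul_self_eq (u := rePart a)
      fun e => (Complex.nonneg_iff.1 (hval e)).1
    refine ⟨b, ?_⟩
    rw [cpNull_eq, mem_singleton_iff, sub_eq_zero, ← hb, ← ha']
  · simp only [boundarySeminorm, lipSeminorm, ContinuousMap.star_apply, ← star_sub, norm_star]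
  · refine lowerSemicontinuous_iSup fun e => lowerSemicontinuous_iSup fun e' =>
      lowerSemicontinuous_iSup fun _ => Continuous.lowerSemicontinuous ?_
    refine ENNReal.continuous_ofReal.comp (Continuous.div_const (Continuous.norm ?_) _)
    exact (continuous_eval_const e).sub (continuous_eval_const e')
  · refine Metric.dense_iff.2 fun a r hr => ?_
    obtain ⟨g, ⟨C, hC⟩, hg⟩ := hd.exists_lipschitz_near a hr
    refine ⟨g, by rwa [Metric.mem_ball, dist_comm, dist_eq_norm], ?_⟩
    refine lt_of_le_of_lt ((hd.lipSeminorm_le_iff (le_max_right C 0)).2 fun e e' =>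
      (hC e e').trans ?_) ENNReal.ofReal_lt_top
    exact mul_le_mul_of_nonneg_right (le_max_left _ _) (hd.nonneg e e')
  · rw [hd.lipSeminorm_eq_zero_iff, cpNull_eq, union_singleton, Submodule.span_insert_zero,
      Submodule.mem_span_singleton]
    constructor
    · intro h
      obtain ⟨x, hx⟩ := hX.nonempty
      obtain ⟨e₀⟩ := (hX.reprMeasure ⟨x, hx⟩).nonempty
      refine ⟨a e₀, ?_⟩
      ext e
      simpa using h e₀ e
    · rintro ⟨c, rfl⟩ e e'
      rfl

end IsMetricBauerSimplex

end BauerTraces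

lemma MetricBauerSimplex.gap_eq_quantumGap (X Y : MetricBauerSimplex.{u}) :
    X.gap Y = quantumGap X.bdryLip Y.bdryLip :=
  intertwiningGap_congr X.isMetricBauerSimplex.traceIsometry Y.isMetricBauerSimplex.traceIsometry
    X.isMetricBauerSimplex.toIsCompactConvexMetric
    X.isMetricBauerSimplex.isMetricBauerSimplex_traces.toIsCompactConvexMetric
    Y.isMetricBauerSimplex.toIsCompactConvexMetric
    Y.isMetricBauerSimplex.isMetricBauerSimplex_traces.toIsCompactConvexMetric

end QIG

end

theorem mainTheorem3 :
    -- `γ` is a well-defined quasimetric with constant `2` on isomorphism classes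
    (∃ d : QIG.MetricBauerSimplex.Class.{u} → QIG.MetricBauerSimplex.Class.{u} → ℝ,
      (∀ X Y : QIG.MetricBauerSimplex.{u}, ENNReal.ofReal (d X.toClass Y.toClass) = X.gap Y) ∧
      QIG.IsQuasimetric 2 d) ∧
    -- the associated function spaces and algebras are quantum metric spaces, and `γ = γ_q`
    (∀ X : QIG.MetricBauerSimplex.{u},
      QIG.IsCompactQuantumMetricSpace (QIG.Aff.unit X.carrier) X.affLip ∧
      QIG.IsCStarQMBS X.bdryLip) ∧
    (∀ X Y : QIG.MetricBauerSimplex.{u}, X.gap Y = QIG.quantumGap X.bdryLip Y.bdryLip) ∧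
    -- comparison with the quantum Gromov--Hausdorff distance
    (∀ X Y : QIG.MetricBauerSimplex.{u},
      QIG.quantumGap X.bdryLip Y.bdryLip ≤ 2 * X.qdist Y) ∧
    (∀ (X : ℕ → QIG.MetricBauerSimplex.{u}) (Z : QIG.MetricBauerSimplex.{u}),
      Tendsto (fun n => (X n).gap Z) atTop (𝓝 0) ↔
        Tendsto (fun n => (X n).qdist Z) atTop (𝓝 0)) := by
  exact ⟨QIG.MetricBauerSimplex.exists_isQuasimetric,
    fun X => ⟨⟨have := X.isMetricBauerSimplex.compactSpace
        QIG.Aff.isOrderUnitSpace, X.isMetricBauerSimplex.isLipNorm_affSeminorm⟩,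
      X.isMetricBauerSimplex.isCStarQMBS⟩,
    QIG.MetricBauerSimplex.gap_eq_quantumGap,
    fun X Y => (X.gap_eq_quantumGap Y).ge.trans (X.gap_le_qdist Y),
    QIG.MetricBauerSimplex.tendsto_gap_iff_tendsto_qdist⟩
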